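/- Let $(\Omega,\mathcal F,\mathbb F=\{\mathcal F_t\}_{t\in[0,1]},P)$ be a filtered probability space and $X=\{X(t)\}_{t\in[0,1]}$ a real $\mathbb F$-adapted process. Let $\alpha>\tfrac12$ and assume: (i) almost surely there is a finite $C=C(\omega)$ such that $|X(t)-X(s)|\le C|t-s|^{\alpha}$ for all $s,t\in[0,1]$; (ii) there are constants $C>0$ and $\delta\in(0,1]$ such that for all $s<t$ in $[1-\delta,1]$, with $\Delta=t-s$, and all $0<\epsilon\le\Delta^{\alpha}$, $$P\Big(\sup_{s\le u\le t}|X(u)-X(s)|\le\epsilon\Big)\le\exp\big(-C\,\Delta\,\epsilon^{-1/\alpha}\big).$$ For $\beta\in(0,1)$ and $f,g\colon[a,b]\to\mathbb R$ put $g_{b-}(x)=g(x)-g(b)$, $$D_{a+}^{\beta}f(x)=\frac{1}{\Gamma(1-\beta)}\Big(\frac{f(x)}{(x-a)^{\beta}}+\beta\int_a^x\frac{f(x)-f(u)}{(x-u)^{\beta+1}}\,du\Big),$$ $$D_{b-}^{1-\beta}g(x)=\frac{e^{i\pi(1-\beta)}}{\Gamma(\beta)}\Big(\frac{g(x)}{(b-x)^{1-\beta}}+(1-\beta)\int_x^b\frac{g(x)-g(u)}{(u-x)^{2-\beta}}\,du\Big),$$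 $$\|f\|_{\beta;[a,b]}=\int_a^b\Big(\frac{|f(t)|}{(t-a)^{\beta}}+\int_a^t\frac{|f(t)-f(s)|}{(t-s)^{\beta+1}}\,ds\Big)dt.$$ The generalized Lebesgue--Stieltjes integral (with index $\beta$) $$\int_a^b f\,dg=e^{i\pi\beta}\int_a^b D_{a+}^{\beta}f(x)\,D_{b-}^{1-\beta}g_{b-}(x)\,dx$$ is said to exist if $\|f\|_{\beta;[a,b]}<\infty$, the inner integrals converge for almost every $x\in[a,b]$, $D_{a+}^{\beta}f\in L_1[a,b]$ and $D_{b-}^{1-\beta}g_{b-}\in L_\infty[a,b]$. Then there is an $\mathbb F$-adapted process $\phi=\{\phi(t)\}_{t\in[0,1)}$ with continuous paths and $\phi(0)=0$ such that, almost surely, for every $\beta\in(0,1)$ with $\beta>1-\alpha$, the integral $\int_0^t\phi(s)\,dX(s)$ exists with index $\beta$ for every $t\in[0,1)$ and $$\lim_{t\to1-}\int_0^t\phi(s)\,dX(s)=+\infty .$$ -/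

import Mathlib

open MeasureTheory Filter Topology

noncomputable section

/-- Left-sided (Weyl–Marchaud) fractional derivative `D_{a+}^β f` of order `β ∈ (0,1)`. -/
def leftFracDeriv (a β : ℝ) (f : ℝ → ℝ) (x : ℝ) : ℝ :=
  (1 / Real.Gamma (1 - β)) *
    (f x / (x - a) ^ β + β * ∫ u in a..x, (f x - f u) / (x - u) ^ (β + 1))

/-- Right-sided (Weyl–Marchaud) fractional derivative `D_{b-}^β g` of order `β ∈ (0,1)`, without
the conventional unimodular constant `(-1)^β = e^{iπβ}`; that constant is accounted for in
`glsIntegral`. -/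
def rightFracDeriv (b β : ℝ) (g : ℝ → ℝ) (x : ℝ) : ℝ :=
  (1 / Real.Gamma (1 - β)) *
    (g x / (b - x) ^ β + β * ∫ u in x..b, (g x - g u) / (u - x) ^ (β + 1))

/-- The norm `‖f‖_{β;[a,b]}`, with values in `[0,∞]`. -/
def glsNorm (β : ℝ) (f : ℝ → ℝ) (a b : ℝ) : ENNReal :=
  ∫⁻ t in Set.Ioc a b,
    (ENNReal.ofReal (|f t| / (t - a) ^ β) +
      ∫⁻ s in Set.Ioc a t, ENNReal.ofReal (|f t - f s| / (t - s) ^ (β + 1)))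

/-- The generalized Lebesgue–Stieltjes integral `∫_a^b f dg` exists with index `β`:
`f` is an admissible integrand (`‖f‖_{β;[a,b]} < ∞`), the fractional derivatives
`D_{a+}^β f` and `D_{b-}^{1-β} g_{b-}`, where `g_{b-} = g - g(b)`, are given by convergent integrals
almost everywhere on `[a,b]`, and they belong to `L_1[a,b]` and `L_∞[a,b]` respectively. -/
structure GLSIntegrable (β : ℝ) (f g : ℝ → ℝ) (a b : ℝ) : Prop where
  norm_lt_top : glsNorm β f a b < ⊤
  left_inner : ∀ᵐ x ∂(volume.restrict (Set.Ioc a b)),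
    IntervalIntegrable (fun u => (f x - f u) / (x - u) ^ (β + 1)) volume a x
  left_memLp : MemLp (leftFracDeriv a β f) 1 (volume.restrict (Set.Ioc a b))
  right_inner : ∀ᵐ x ∂(volume.restrict (Set.Ioc a b)),
    IntervalIntegrable (fun u => (g x - g u) / (u - x) ^ (1 - β + 1)) volume x b
  right_memLp : MemLp (rightFracDeriv b (1 - β) (fun x => g x - g b)) ⊤
    (volume.restrict (Set.Ioc a b))

/-- The generalized Lebesgue–Stieltjes integral
`∫_a^b f dg = (-1)^β ∫_a^b (D_{a+}^β f)(x) (D_{b-}^{1-β} g_{b-})(x) dx`.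
The minus sign is the product `(-1)^β (-1)^{1-β} = e^{iπβ} e^{iπ(1-β)} = -1` of the unimodular
constants; with it `∫_a^b 1 dg = g(b) - g(a)`. -/
def glsIntegral (β : ℝ) (f g : ℝ → ℝ) (a b : ℝ) : ℝ :=
  -∫ x in a..b, leftFracDeriv a β f x * rightFracDeriv b (1 - β) (fun y => g y - g b) x

/-- Almost every path of `X` is `α`-Hölder on `[0,1]`; the constant may depend on the path. -/
def HasHolderPaths {Ω : Type*} [MeasurableSpace Ω] (P : Measure Ω) (X : ℝ → Ω → ℝ) (α : ℝ) :
    Prop :=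
  ∀ᵐ ω ∂P, ∃ C : ℝ, ∀ s ∈ Set.Icc (0 : ℝ) 1, ∀ t ∈ Set.Icc (0 : ℝ) 1,
    |X t ω - X s ω| ≤ C * |t - s| ^ α

/-- Small ball estimate near the end point `1`: for `s < t` in `[1-δ,1]`, `Δ = t - s` and
`0 < ε ≤ Δ^α`, the event `sup_{s ≤ u ≤ t} |X(u) - X(s)| ≤ ε` has probability at most
`exp (-C Δ ε^{-1/α})`. -/
def HasSmallBallEstimate {Ω : Type*} [MeasurableSpace Ω] (P : Measure Ω) (X : ℝ → Ω → ℝ)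
    (α : ℝ) : Prop :=
  ∃ C : ℝ, 0 < C ∧ ∃ δ : ℝ, 0 < δ ∧ δ ≤ 1 ∧
    ∀ s ∈ Set.Icc (1 - δ) 1, ∀ t ∈ Set.Icc (1 - δ) 1, s < t →
      ∀ ε : ℝ, 0 < ε → ε ≤ (t - s) ^ α →
        P {ω | ∀ u ∈ Set.Icc s t, |X u ω - X s ω| ≤ ε} ≤
          ENNReal.ofReal (Real.exp (-(C * (t - s) * ε ^ (-(1 / α)))))

end

/-! ### Kernels -/

/-! Read `φ` as a trading strategy in the asset `X`. Split a left neighbourhood of time one into the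
blocks `[1 - δ/2^n, 1 - δ/2^(n+1)]`. On a grid in block `n`, hold `2/ε²` times the displacement of
`X` from its value at the block's start, until a grid value is displaced by at least `ε`; then hold
nothing. Since `2(y_k - y_0)(y_{k+1} - y_k)` is a telescoping difference of squares minus a squared
increment, the gain is at least 1 if the level is reached and nonnegative otherwise, up to a
discrete quadratic variation that a fine mesh makes small because `α > 1/2`
(`sum_stoppedPosition_mul_sub_ge`, `exists_mesh`).

The small ball estimate and Borel–Cantelli show that almost surely all but finitely many blocks
reach their level (`ae_eventually_exists_large_increment`). The losses in the other blocks, and in a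
block still in progress, are summable, so the accumulated gain tends to infinity
(`GridSequence.tendsto_glsIntegral_strategy`).

Continuity of `φ` comes from replacing each jump of the position by a smooth step of short duration
`θ` after the grid point. The delay preserves adaptedness and costs `O(θ^α)`
(`abs_integral_smoothStepDeriv_sub_le`).

The analytic input is that for a `C¹` integrand `f` with `f a = 0` the generalized
Lebesgue–Stieltjes integral equals `∫ f'(u) (g b - g u) du` (`glsIntegral_eq_of_holder`). Every gain
is estimated from this formula, in which `β` no longer occurs. -/

theorem integral_beta_kernel {β u v : ℝ} (h0 : 0 < β) (h1 : β < 1) (huv : u < v) :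
    ∫ x in u..v, (x - u) ^ (-β) * (v - x) ^ (β - 1) = Real.Gamma (1 - β) * Real.Gamma β := by
  have hshift : ∫ x in u..v, (x - u) ^ (-β) * (v - x) ^ (β - 1)
      = ∫ y in (0 : ℝ)..(v - u), y ^ (-β) * (v - u - y) ^ (β - 1) := by
    have := intervalIntegral.integral_comp_sub_right (a := u) (b := v)
      (fun y : ℝ => y ^ (-β) * (v - u - y) ^ (β - 1)) u
    simp only [sub_self] at this
    rw [← this]
    congr 1
    ext x
    congr 2
    ring
  rw [hshift]
  have hpos : 0 < v - u := sub_pos.2 huv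
  have hc := Complex.betaIntegral_scaled ((1 - β : ℝ) : ℂ) ((β : ℝ) : ℂ) hpos
  have hG := Complex.Gamma_mul_Gamma_eq_betaIntegral (s := ((1 - β : ℝ) : ℂ)) (t := ((β : ℝ) : ℂ))
    (by simpa using h1) (by simpa using h0)
  -- The Beta exponents sum to 1, so the scale factor is `(v - u)^0`: the value does not depend on
  -- `u` and `v`.
  have e1 : ((1 - β : ℝ) : ℂ) + (β : ℂ) = 1 := by push_cast; ring
  rw [e1, Complex.Gamma_one, one_mul] at hG
  rw [e1, sub_self, Complex.cpow_zero, one_mul, ← hG, Complex.Gamma_ofReal, Complex.Gamma_ofReal]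
    at hc
  have h2 : ∫ x in (0 : ℝ)..(v - u), (x : ℂ) ^ (((1 - β : ℝ) : ℂ) - 1) *
        (((v - u : ℝ) : ℂ) - x) ^ ((β : ℂ) - 1)
      = ∫ x in (0 : ℝ)..(v - u), ((x ^ (-β) * (v - u - x) ^ (β - 1) : ℝ) : ℂ) := by
    apply intervalIntegral.integral_congr
    intro x hx
    rw [Set.uIcc_of_le hpos.le] at hx
    have e2 : (((1 - β : ℝ) : ℂ) - 1) = ((-β : ℝ) : ℂ) := by push_cast; ring
    have e3 : (β : ℂ) - 1 = ((β - 1 : ℝ) : ℂ) := by push_cast; ring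
    simp only
    rw [e2, e3, ← Complex.ofReal_sub, ← Complex.ofReal_cpow hx.1,
      ← Complex.ofReal_cpow (sub_nonneg.2 hx.2), ← Complex.ofReal_mul]
  rw [h2, intervalIntegral.integral_ofReal] at hc
  exact_mod_cast hc

/-- A non-integrable function has Bochner integral zero by convention, so the positive value just
computed forces integrability. -/
theorem integrableOn_beta_kernel {β u v : ℝ} (h0 : 0 < β) (h1 : β < 1) (huv : u < v) :
    IntegrableOn (fun x => (x - u) ^ (-β) * (v - x) ^ (β - 1)) (Set.Ioc u v) := by
  have h := integral_beta_kernel h0 h1 huv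
  rw [intervalIntegral.integral_of_le huv.le] at h
  apply Integrable.of_integral_ne_zero
  rw [h]
  exact (mul_pos (Real.Gamma_pos_of_pos (by linarith)) (Real.Gamma_pos_of_pos h0)).ne'

theorem intervalIntegrable_sub_rpow {r : ℝ} (hr : -1 < r) (a x : ℝ) :
    IntervalIntegrable (fun u => (x - u) ^ r) volume a x := by
  have := (intervalIntegral.intervalIntegrable_rpow' (a := x - a) (b := 0) hr).comp_sub_left x
  simpa using this

theorem integral_sub_rpow {r : ℝ} (hr : -1 < r) (a x : ℝ) :
    ∫ u in a..x, (x - u) ^ r = (x - a) ^ (r + 1) / (r + 1) := by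
  rw [intervalIntegral.integral_comp_sub_left (fun y : ℝ => y ^ r) x, integral_rpow (Or.inl hr),
    sub_self, Real.zero_rpow (by linarith), sub_zero]

theorem measurable_intervalIntegral_of_measurable {F : ℝ → ℝ → ℝ}
    (hF : Measurable (Function.uncurry F)) (a : ℝ) :
    Measurable fun x => ∫ u in a..x, F x u := by
  have key : ∀ s : Set (ℝ × ℝ), MeasurableSet s →
      Measurable fun x => ∫ u, s.indicator (Function.uncurry F) (x, u) := fun s hs =>
    (StronglyMeasurable.integral_prod_right
      (f := fun x u => s.indicator (Function.uncurry F) (x, u))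
      (hF.indicator hs).stronglyMeasurable).measurable
  have e : (fun x => ∫ u in a..x, F x u) = fun x =>
      (∫ u, {z : ℝ × ℝ | a < z.2 ∧ z.2 ≤ z.1}.indicator (Function.uncurry F) (x, u)) -
      ∫ u, {z : ℝ × ℝ | z.1 < z.2 ∧ z.2 ≤ a}.indicator (Function.uncurry F) (x, u) := by
    ext x
    rw [intervalIntegral, ← integral_indicator measurableSet_Ioc,
      ← integral_indicator measurableSet_Ioc]
    congr 1
  rw [e]
  exact (key _ ((measurableSet_lt measurable_const measurable_snd).inter
      (measurableSet_le measurable_snd measurable_fst))).sub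
    (key _ ((measurableSet_lt measurable_fst measurable_snd).inter
      (measurableSet_le measurable_snd measurable_const)))

/-! ### Fractional derivatives of Hölder functions -/

theorem nonneg_of_holder {f : ℝ → ℝ} {C r : ℝ} (hf : ∀ x y, |f x - f y| ≤ C * |x - y| ^ r) :
    0 ≤ C := by
  have := (abs_nonneg _).trans (hf 1 0)
  simpa using this

theorem continuous_of_holder {f : ℝ → ℝ} {C r : ℝ} (hr : 0 < r)
    (hf : ∀ x y, |f x - f y| ≤ C * |x - y| ^ r) : Continuous f := by
  rw [continuous_iff_continuousAt]
  intro y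
  rw [ContinuousAt, tendsto_iff_norm_sub_tendsto_zero]
  have h : Tendsto (fun x : ℝ => C * |x - y| ^ r) (𝓝 y) (𝓝 0) := by
    have : Continuous fun x : ℝ => C * |x - y| ^ r :=
      continuous_const.mul ((continuous_id.sub continuous_const).abs.rpow_const
        fun _ => Or.inr hr.le)
    have h2 := this.tendsto y
    simpa [Real.zero_rpow hr.ne'] using h2
  exact squeeze_zero (fun _ => norm_nonneg _) (fun x => hf x y) h

/-- This majorant is integrable up to `u = x` when `β < r`; it serves for convergence, for uniform
bounds and for dominated convergence. -/
theorem norm_holder_kernel_le {f : ℝ → ℝ} {C r β : ℝ}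
    (hf : ∀ x y, |f x - f y| ≤ C * |x - y| ^ r) {x u : ℝ} (hu : u ≤ x) :
    ‖(f x - f u) / (x - u) ^ (β + 1)‖ ≤ C * (x - u) ^ (r - β - 1) := by
  rcases hu.eq_or_lt with rfl | hu
  · simpa using mul_nonneg (nonneg_of_holder hf) (Real.rpow_nonneg le_rfl _)
  have hpos : 0 < x - u := sub_pos.2 hu
  have h := hf x u
  rw [abs_of_pos hpos] at h
  rw [Real.norm_eq_abs, abs_div, abs_of_pos (Real.rpow_pos_of_pos hpos _),
    div_le_iff₀ (Real.rpow_pos_of_pos hpos _), mul_assoc, ← Real.rpow_add hpos]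
  rwa [show r - β - 1 + (β + 1) = r by ring]

theorem intervalIntegrable_holder_kernel {f : ℝ → ℝ} {C r β : ℝ}
    (hf : ∀ x y, |f x - f y| ≤ C * |x - y| ^ r) (hr : β < r) (hβ : 0 < β) {a x : ℝ} (hax : a ≤ x) :
    IntervalIntegrable (fun u => (f x - f u) / (x - u) ^ (β + 1)) volume a x := by
  refine ((intervalIntegrable_sub_rpow (r := r - β - 1) (by linarith) a x).const_mul C).mono_fun'
    ?_ ?_
  · have := (continuous_of_holder (hβ.trans hr) hf).measurable
    exact Measurable.aestronglyMeasurable (by fun_prop)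
  · filter_upwards [ae_restrict_mem measurableSet_uIoc] with u hu
    rw [Set.uIoc_of_le hax] at hu
    exact norm_holder_kernel_le hf hu.2

theorem measurable_leftFracDeriv {f : ℝ → ℝ} (hf : Measurable f) (a β : ℝ) :
    Measurable (leftFracDeriv a β f) := by
  unfold leftFracDeriv
  have h : Measurable fun x => ∫ u in a..x, (f x - f u) / (x - u) ^ (β + 1) := by
    apply measurable_intervalIntegral_of_measurable
    unfold Function.uncurry
    fun_prop
  fun_prop

/-- The bound is chosen before `f`, so one constant dominates a whole family of functions with a
common Hölder constant. -/
theorem exists_bound_leftFracDeriv {C r β a b : ℝ} (hr : β < r) (hβ : 0 < β) :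
    ∃ K : ℝ, ∀ f : ℝ → ℝ, (∀ x y, |f x - f y| ≤ C * |x - y| ^ r) → f a = 0 →
      ∀ x ∈ Set.Ioc a b, |leftFracDeriv a β f x| ≤ K := by
  refine ⟨|1 / Real.Gamma (1 - β)| * (C * (b - a) ^ (r - β) +
    β * (C * ((b - a) ^ (r - β) / (r - β)))), fun f hf hfa x hx => ?_⟩
  have hC := nonneg_of_holder hf
  have hpos : 0 < x - a := sub_pos.2 hx.1
  have hmono : (x - a) ^ (r - β) ≤ (b - a) ^ (r - β) :=
    Real.rpow_le_rpow hpos.le (by linarith [hx.2]) (by linarith)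
  unfold leftFracDeriv
  rw [abs_mul]
  refine mul_le_mul_of_nonneg_left ((abs_add_le _ _).trans (add_le_add ?_ ?_)) (abs_nonneg _)
  · have h := hf x a
    rw [hfa, sub_zero, abs_of_pos hpos] at h
    rw [abs_div, abs_of_pos (Real.rpow_pos_of_pos hpos β), div_le_iff₀ (Real.rpow_pos_of_pos hpos _)]
    calc |f x| ≤ C * (x - a) ^ r := h
      _ = C * (x - a) ^ (r - β) * (x - a) ^ β := by
        rw [mul_assoc, ← Real.rpow_add hpos]; congr 2; ring
      _ ≤ _ := by gcongr
  · rw [abs_mul, abs_of_pos hβ]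
    refine mul_le_mul_of_nonneg_left ?_ hβ.le
    have h := intervalIntegral.norm_integral_le_of_norm_le (μ := volume) hx.1.le
      (f := fun u => (f x - f u) / (x - u) ^ (β + 1)) (g := fun u => C * (x - u) ^ (r - β - 1))
      (Eventually.of_forall fun u hu => norm_holder_kernel_le hf hu.2)
      ((intervalIntegrable_sub_rpow (by linarith) a x).const_mul C)
    rw [intervalIntegral.integral_const_mul, integral_sub_rpow (by linarith), sub_add_cancel] at h
    refine h.trans ?_
    have : 0 < r - β := by linarith
    gcongr

/-- Time reversal reduces estimates of the right derivative to those of the left one. -/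
theorem rightFracDeriv_eq_leftFracDeriv_neg (b β : ℝ) (g : ℝ → ℝ) (x : ℝ) :
    rightFracDeriv b β g x = leftFracDeriv (-b) β (fun y => g (-y)) (-x) := by
  unfold rightFracDeriv leftFracDeriv
  rw [← intervalIntegral.integral_comp_neg]
  simp only [neg_neg, sub_neg_eq_add, neg_add_eq_sub]

theorem holder_comp_neg {f : ℝ → ℝ} {C r : ℝ} (hf : ∀ x y, |f x - f y| ≤ C * |x - y| ^ r) (c : ℝ) :
    ∀ x y, |(f (-x) - c) - (f (-y) - c)| ≤ C * |x - y| ^ r := by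
  intro x y
  have := hf (-x) (-y)
  rw [show |-x - -y| = |x - y| by rw [← abs_neg]; congr 1; ring] at this
  simpa using this

theorem glsNorm_lt_top {f : ℝ → ℝ} {C r β : ℝ} (hf : ∀ x y, |f x - f y| ≤ C * |x - y| ^ r)
    (hr : β < r) {a b : ℝ} (hfa : f a = 0) : glsNorm β f a b < ⊤ := by
  have hC := nonneg_of_holder hf
  have hbd : ∀ t ∈ Set.Ioc a b, (ENNReal.ofReal (|f t| / (t - a) ^ β) +
      ∫⁻ s in Set.Ioc a t, ENNReal.ofReal (|f t - f s| / (t - s) ^ (β + 1))) ≤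
      ENNReal.ofReal (C * (b - a) ^ (r - β)) +
        ENNReal.ofReal (C * ((b - a) ^ (r - β) / (r - β))) := by
    intro t ht
    have hpos : 0 < t - a := sub_pos.2 ht.1
    have hmono : (t - a) ^ (r - β) ≤ (b - a) ^ (r - β) :=
      Real.rpow_le_rpow hpos.le (by linarith [ht.2]) (by linarith)
    have hrb : 0 < r - β := by linarith
    refine add_le_add (ENNReal.ofReal_le_ofReal ?_) ?_
    · have h := hf t a
      rw [hfa, sub_zero, abs_of_pos hpos] at h
      rw [div_le_iff₀ (Real.rpow_pos_of_pos hpos _)]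
      calc |f t| ≤ C * (t - a) ^ r := h
        _ = C * (t - a) ^ (r - β) * (t - a) ^ β := by
          rw [mul_assoc, ← Real.rpow_add hpos]; congr 2; ring
        _ ≤ _ := by gcongr
    · calc ∫⁻ s in Set.Ioc a t, ENNReal.ofReal (|f t - f s| / (t - s) ^ (β + 1))
          ≤ ∫⁻ s in Set.Ioc a t, ENNReal.ofReal (C * (t - s) ^ (r - β - 1)) := by
            refine setLIntegral_mono' measurableSet_Ioc fun s hs => ENNReal.ofReal_le_ofReal ?_
            have h := norm_holder_kernel_le (β := β) hf hs.2
            rwa [Real.norm_eq_abs, abs_div,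
              abs_of_nonneg (Real.rpow_nonneg (sub_nonneg.2 hs.2) _)] at h
        _ = ENNReal.ofReal (∫ s in Set.Ioc a t, C * (t - s) ^ (r - β - 1)) := by
            rw [ofReal_integral_eq_lintegral_ofReal]
            · exact ((intervalIntegrable_iff_integrableOn_Ioc_of_le ht.1.le).1
                ((intervalIntegrable_sub_rpow (by linarith) a t).const_mul C))
            · filter_upwards [ae_restrict_mem measurableSet_Ioc] with s hs
              exact mul_nonneg hC (Real.rpow_nonneg (sub_nonneg.2 hs.2) _)
        _ ≤ _ := by
            rw [← intervalIntegral.integral_of_le ht.1.le, intervalIntegral.integral_const_mul,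
              integral_sub_rpow (by linarith), sub_add_cancel]
            gcongr
  refine (setLIntegral_mono' measurableSet_Ioc hbd).trans_lt ?_
  rw [setLIntegral_const]
  exact ENNReal.mul_lt_top (ENNReal.add_lt_top.2 ⟨ENNReal.ofReal_lt_top, ENNReal.ofReal_lt_top⟩)
    measure_Ioc_lt_top

theorem glsIntegrable_of_holder {f g : ℝ → ℝ} {C C' r α β : ℝ}
    (hf : ∀ x y, |f x - f y| ≤ C * |x - y| ^ r) (hg : ∀ x y, |g x - g y| ≤ C' * |x - y| ^ α)
    (hβ : 0 < β) (hβ1 : β < 1) (hr : β < r) (hα : 1 - β < α) {a b : ℝ} (hfa : f a = 0) :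
    GLSIntegrable β f g a b where
  norm_lt_top := glsNorm_lt_top hf hr hfa
  left_inner := by
    filter_upwards [ae_restrict_mem measurableSet_Ioc] with x hx
    exact intervalIntegrable_holder_kernel hf hr hβ hx.1.le
  left_memLp := by
    obtain ⟨K, hK⟩ := exists_bound_leftFracDeriv (C := C) (a := a) (b := b) hr hβ
    refine MemLp.of_bound (measurable_leftFracDeriv
      (continuous_of_holder (hβ.trans hr) hf).measurable _ _).aestronglyMeasurable K ?_
    filter_upwards [ae_restrict_mem measurableSet_Ioc] with x hx using hK f hf hfa x hx
  right_inner := by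
    filter_upwards [ae_restrict_mem measurableSet_Ioc] with x hx
    have h := intervalIntegrable_holder_kernel (holder_comp_neg hg 0) hα (by linarith)
      (neg_le_neg hx.2)
    have h2 := (h.comp_sub_left 0).symm
    simpa [neg_add_eq_sub] using h2
  right_memLp := by
    obtain ⟨K, hK⟩ := exists_bound_leftFracDeriv (C := C') (a := -b) (b := -a + 1) hα
      (by linarith)
    have hm := (continuous_of_holder (lt_trans (by linarith) hα) (holder_comp_neg hg (g b))).measurable
    have e : rightFracDeriv b (1 - β) (fun x => g x - g b) =
        fun x => leftFracDeriv (-b) (1 - β) (fun y => g (-y) - g b) (-x) := by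
      ext x; exact rightFracDeriv_eq_leftFracDeriv_neg _ _ _ _
    -- The reflected half-open interval omits the image of `x = b`, so the value there enters the
    -- bound separately.
    refine MemLp.of_bound ?_ (max K |rightFracDeriv b (1 - β) (fun x => g x - g b) b|) ?_
    · rw [e]
      exact ((measurable_leftFracDeriv hm _ _).comp measurable_neg).aestronglyMeasurable
    · filter_upwards [ae_restrict_mem measurableSet_Ioc] with x hx
      rcases hx.2.eq_or_lt with rfl | hxb
      · exact le_max_right _ _
      · rw [e]
        exact (hK _ (holder_comp_neg hg (g b)) (by simp) (-x)
          ⟨by linarith, by linarith [hx.1]⟩).trans (le_max_left _ _)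


/-! ### Integration by parts for continuously differentiable functions -/

theorem lipschitz_of_hasDerivAt {f p : ℝ → ℝ} {L : ℝ} (hf : ∀ x, HasDerivAt f (p x) x)
    (hp : ∀ x, |p x| ≤ L) (x y : ℝ) : |f x - f y| ≤ L * |x - y| ^ (1 : ℝ) := by
  rw [Real.rpow_one]
  exact convex_univ.norm_image_sub_le_of_norm_hasDerivWithin_le
    (fun x _ => (hf x).hasDerivWithinAt) (fun x _ => hp x) (Set.mem_univ y) (Set.mem_univ x)

/-- Integrate the derivative of `u ↦ (f x - f u) (x - u)^(-β)` over `[a, x]`. The boundary term at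
`x` vanishes because `f` is Lipschitz and `β < 1`; the one at `a` is the non-integral term of the
fractional derivative. What remains is a fractional integral of `p`. -/
theorem leftFracDeriv_eq_of_hasDerivAt {f p : ℝ → ℝ} {L β a x : ℝ}
    (hf : ∀ x, HasDerivAt f (p x) x) (hpc : Continuous p) (hp : ∀ x, |p x| ≤ L)
    (hβ : 0 < β) (hβ1 : β < 1) (hfa : f a = 0) (hax : a ≤ x) :
    leftFracDeriv a β f x = 1 / Real.Gamma (1 - β) * ∫ u in a..x, (x - u) ^ (-β) * p u := by
  rcases hax.eq_or_lt with rfl | hax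
  · simp [leftFracDeriv, hfa]
  have hlip := lipschitz_of_hasDerivAt hf hp
  have hfc : Continuous f := continuous_iff_continuousAt.2 fun x => (hf x).continuousAt
  unfold leftFracDeriv
  congr 1
  have hI1 : IntervalIntegrable (fun u => (x - u) ^ (-β) * p u) volume a x :=
    (intervalIntegrable_sub_rpow (by linarith) a x).mul_continuousOn hpc.continuousOn
  have hI2 := intervalIntegrable_holder_kernel hlip hβ1 hβ hax.le
  have hcont : ContinuousOn (fun u => (f x - f u) * (x - u) ^ (-β)) (Set.Icc a x) := by
    intro u hu
    rcases hu.2.eq_or_lt with rfl | hux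
    · rw [ContinuousWithinAt, sub_self, zero_mul]
      have h0 : Tendsto (fun v : ℝ => L * (u - v) ^ (1 - β)) (𝓝[Set.Icc a u] u) (𝓝 0) := by
        have : Continuous fun v : ℝ => L * (u - v) ^ (1 - β) :=
          continuous_const.mul ((continuous_const.sub continuous_id).rpow_const
            fun _ => Or.inr (by linarith))
        have h2 := this.tendsto u
        rw [sub_self, Real.zero_rpow (by linarith), mul_zero] at h2
        exact h2.mono_left nhdsWithin_le_nhds
      refine squeeze_zero_norm' ?_ h0
      filter_upwards [self_mem_nhdsWithin] with v hv
      rcases hv.2.eq_or_lt with rfl | hvu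
      · simp [Real.zero_rpow (show 1 - β ≠ 0 by linarith)]
      have hpos : 0 < u - v := sub_pos.2 hvu
      have h := hlip u v
      rw [abs_of_pos hpos] at h
      rw [norm_mul, Real.norm_eq_abs, Real.norm_of_nonneg (Real.rpow_nonneg hpos.le _)]
      calc |f u - f v| * (u - v) ^ (-β) ≤ L * (u - v) ^ (1 : ℝ) * (u - v) ^ (-β) := by gcongr
        _ = L * (u - v) ^ (1 - β) := by
          rw [mul_assoc, ← Real.rpow_add hpos, ← sub_eq_add_neg]
    · refine ((continuousAt_const.sub hfc.continuousAt).mul ?_).continuousWithinAt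
      exact (continuousAt_const.sub continuousAt_id).rpow_const (Or.inl (by simpa using sub_ne_zero.2 hux.ne'))
  have hderiv : ∀ u ∈ Set.Ioo a x, HasDerivAt (fun u => (f x - f u) * (x - u) ^ (-β))
      (β * ((f x - f u) / (x - u) ^ (β + 1)) - (x - u) ^ (-β) * p u) u := by
    intro u hu
    have hpos : 0 < x - u := sub_pos.2 hu.2
    have h1 : HasDerivAt (fun u => f x - f u) (-p u) u := (hf u).const_sub (f x)
    have h2 : HasDerivAt (fun u => x - u) (-1) u := (hasDerivAt_id u).const_sub x
    have h3 := h1.mul (h2.rpow_const (p := -β) (Or.inl hpos.ne'))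
    refine h3.congr_deriv ?_
    rw [show -β - 1 = -(β + 1) by ring, Real.rpow_neg hpos.le (β + 1)]
    field_simp
    ring
  have key := intervalIntegral.integral_eq_sub_of_hasDerivAt_of_le hax.le hcont hderiv
    ((hI2.const_mul β).sub hI1)
  rw [intervalIntegral.integral_sub (hI2.const_mul β) hI1, intervalIntegral.integral_const_mul,
    hfa, sub_zero, sub_self, zero_mul, Real.rpow_neg (sub_pos.2 hax).le] at key
  rw [div_eq_mul_inv]
  linarith

theorem rightFracDeriv_eq_of_hasDerivAt {g q : ℝ → ℝ} {L β b x : ℝ}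
    (hg : ∀ x, HasDerivAt g (q x) x) (hqc : Continuous q) (hq : ∀ x, |q x| ≤ L)
    (hβ : 0 < β) (hβ1 : β < 1) (hxb : x ≤ b) :
    rightFracDeriv b β (fun y => g y - g b) x =
      -(1 / Real.Gamma (1 - β) * ∫ u in x..b, (u - x) ^ (-β) * q u) := by
  rw [rightFracDeriv_eq_leftFracDeriv_neg,
    leftFracDeriv_eq_of_hasDerivAt (p := fun y => -q (-y)) (L := L) (fun y => ?_)
      (hqc.comp continuous_neg).neg (fun y => by simpa using hq (-y)) hβ hβ1 (by simp)
      (neg_le_neg hxb), ← intervalIntegral.integral_comp_neg]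
  · simp [neg_add_eq_sub]
  · simpa using ((hg (-y)).comp y (hasDerivAt_neg y)).sub_const (g b)

/-- By Fubini, integrate in `x` first: for fixed `u < v` the kernel contributes the constant `Γ(1-β)
Γ(β)`, leaving the double integral of `p u * q v` over `u < v`. Absolute integrability holds because
the kernel is nonnegative and `p`, `q` are bounded. -/
theorem integral_fracIntegral_mul_fracIntegral {p q : ℝ → ℝ} {L L' β a b : ℝ}
    (hpc : Continuous p) (hp : ∀ x, |p x| ≤ L) (hqc : Continuous q) (hq : ∀ x, |q x| ≤ L')
    (hβ : 0 < β) (hβ1 : β < 1) (hab : a ≤ b) :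
    ∫ x in a..b, (∫ u in a..x, (x - u) ^ (-β) * p u) * ∫ v in x..b, (v - x) ^ (β - 1) * q v =
      Real.Gamma (1 - β) * Real.Gamma β * ∫ u in a..b, p u * ∫ v in u..b, q v := by
  set B : ℝ := Real.Gamma (1 - β) * Real.Gamma β with hB
  have hL : 0 ≤ L := (abs_nonneg _).trans (hp 0)
  have hL' : 0 ≤ L' := (abs_nonneg _).trans (hq 0)
  have hpm := hpc.measurable
  have hqm := hqc.measurable
  let k₁ : ℝ → ℝ → ℝ := fun x => (Set.Ioc a x).indicator fun u => (x - u) ^ (-β) * p u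
  let k₂ : ℝ → ℝ → ℝ := fun x => (Set.Ioc x b).indicator fun v => (v - x) ^ (β - 1) * q v
  let H : ℝ → ℝ × ℝ → ℝ := fun x z => k₁ x z.1 * k₂ x z.2
  let W : ℝ × ℝ → ℝ := fun z => if a < z.1 ∧ z.1 < z.2 ∧ z.2 ≤ b then p z.1 * q z.2 else 0
  have hk : ∀ z : ℝ × ℝ, (fun x => H x z) = fun x =>
      W z * (Set.Ioc z.1 z.2).indicator (fun x => (x - z.1) ^ (-β) * (z.2 - x) ^ (β - 1)) x := by
    rintro ⟨u, v⟩
    ext x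
    simp only [H, k₁, k₂, W, Set.indicator_apply, Set.mem_Ioc]
    -- The half-open intervals on the two sides disagree when `x = u` or `x = v`, but there `0 ^
    -- (-β) = 0` and `0 ^ (β - 1) = 0`.
    by_cases hxu : x = u
    · subst hxu
      simp [Real.zero_rpow (show -β ≠ 0 by linarith)]
    by_cases hxv : x = v
    · subst hxv
      simp [Real.zero_rpow (show β - 1 ≠ 0 by linarith)]
    by_cases h1 : u < x
    · by_cases h2 : x < v
      · by_cases h3 : a < u
        · by_cases h4 : v ≤ b
          · simp only [h1, h1.le, h2, h2.le, h3, h4, h1.trans h2, and_self, if_true]; ring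
          · simp [h4]
        · simp [h3]
      · simp [h2, show ¬ x ≤ v from fun h => h2 (lt_of_le_of_ne h hxv)]
    · simp [h1, show ¬ u ≤ x from fun h => h1 (lt_of_le_of_ne h (Ne.symm hxu))]
  have hWm : Measurable W := by
    refine Measurable.ite ?_ (by fun_prop) measurable_const
    exact (measurableSet_lt measurable_const measurable_fst).inter
      ((measurableSet_lt measurable_fst measurable_snd).inter
        (measurableSet_le measurable_snd measurable_const))
  have hW0 : ∀ z : ℝ × ℝ, ¬ z.1 < z.2 → W z = 0 := fun z hz => by simp [W, hz]
  have hWi : Integrable W := by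
    have hfin : volume (Set.Ioc a b ×ˢ Set.Ioc a b) < ⊤ := by
      rw [Measure.volume_eq_prod, Measure.prod_prod]
      exact ENNReal.mul_lt_top measure_Ioc_lt_top measure_Ioc_lt_top
    refine Integrable.mono' (g := (Set.Ioc a b ×ˢ Set.Ioc a b).indicator fun _ => L * L') ?_
      hWm.aestronglyMeasurable (Eventually.of_forall fun z => ?_)
    · rw [integrable_indicator_iff (measurableSet_Ioc.prod measurableSet_Ioc)]
      exact integrableOn_const hfin.ne
    · simp only [W]
      split_ifs with h
      · rw [Set.indicator_of_mem, norm_mul]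
        · exact mul_le_mul (hp _) (hq _) (norm_nonneg _) hL
        · exact ⟨⟨h.1, h.2.1.le.trans h.2.2⟩, ⟨h.1.trans h.2.1, h.2.2⟩⟩
      · rw [norm_zero]
        exact Set.indicator_nonneg (fun _ _ => mul_nonneg hL hL') _
  have hHm : Measurable (Function.uncurry H) := by
    have e1 : Measurable fun w : ℝ × (ℝ × ℝ) => k₁ w.1 w.2.1 := by
      have : (fun w : ℝ × (ℝ × ℝ) => k₁ w.1 w.2.1) =
          {w : ℝ × (ℝ × ℝ) | a < w.2.1 ∧ w.2.1 ≤ w.1}.indicator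
            fun w => (w.1 - w.2.1) ^ (-β) * p w.2.1 := by ext w; rfl
      rw [this]
      refine Measurable.indicator (by fun_prop) (MeasurableSet.inter
        (s₁ := {w : ℝ × (ℝ × ℝ) | a < w.2.1}) (s₂ := {w : ℝ × (ℝ × ℝ) | w.2.1 ≤ w.1}) ?_ ?_)
      · exact measurableSet_lt (by fun_prop) (by fun_prop)
      · exact measurableSet_le (by fun_prop) (by fun_prop)
    have e2 : Measurable fun w : ℝ × (ℝ × ℝ) => k₂ w.1 w.2.2 := by
      have : (fun w : ℝ × (ℝ × ℝ) => k₂ w.1 w.2.2) =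
          {w : ℝ × (ℝ × ℝ) | w.1 < w.2.2 ∧ w.2.2 ≤ b}.indicator
            fun w => (w.2.2 - w.1) ^ (β - 1) * q w.2.2 := by ext w; rfl
      rw [this]
      refine Measurable.indicator (by fun_prop) (MeasurableSet.inter
        (s₁ := {w : ℝ × (ℝ × ℝ) | w.1 < w.2.2}) (s₂ := {w : ℝ × (ℝ × ℝ) | w.2.2 ≤ b}) ?_ ?_)
      · exact measurableSet_lt (by fun_prop) (by fun_prop)
      · exact measurableSet_le (by fun_prop) (by fun_prop)
    exact e1.mul e2
  have hker : ∀ z : ℝ × ℝ, z.1 < z.2 → Integrable ((Set.Ioc z.1 z.2).indicator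
      fun x => (x - z.1) ^ (-β) * (z.2 - x) ^ (β - 1)) := fun z hz =>
    (integrable_indicator_iff measurableSet_Ioc).2 (integrableOn_beta_kernel hβ hβ1 hz)
  have hkerI : ∀ z : ℝ × ℝ, z.1 < z.2 → ∫ x, (Set.Ioc z.1 z.2).indicator
      (fun x => (x - z.1) ^ (-β) * (z.2 - x) ^ (β - 1)) x = B := fun z hz => by
    rw [integral_indicator measurableSet_Ioc, ← intervalIntegral.integral_of_le hz.le,
      integral_beta_kernel hβ hβ1 hz]
  have hint : Integrable (Function.uncurry H) (volume.prod volume) := by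
    rw [integrable_prod_iff' hHm.aestronglyMeasurable]
    refine ⟨Eventually.of_forall fun z => ?_, ?_⟩
    · change Integrable (fun x => H x z)
      rw [hk]
      by_cases hz : z.1 < z.2
      · exact (hker z hz).const_mul _
      · simp [hW0 z hz]
    · have e : (fun z => ∫ x, ‖Function.uncurry H (x, z)‖) = fun z => ‖W z‖ * B := by
        ext z
        have : ∀ x, ‖Function.uncurry H (x, z)‖ = ‖W z‖ * (Set.Ioc z.1 z.2).indicator
            (fun x => (x - z.1) ^ (-β) * (z.2 - x) ^ (β - 1)) x := fun x => by
          rw [Function.uncurry_apply_pair, congrFun (hk z) x, norm_mul]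
          congr 1
          refine Real.norm_of_nonneg (Set.indicator_nonneg (fun x hx => ?_) _)
          exact mul_nonneg (Real.rpow_nonneg (by linarith [hx.1]) _)
            (Real.rpow_nonneg (by linarith [hx.2]) _)
        simp_rw [this]
        rw [integral_const_mul]
        by_cases hz : z.1 < z.2
        · rw [hkerI z hz]
        · simp [hW0 z hz]
      rw [e]
      exact hWi.norm.mul_const B
  have hlhs : ∫ x in a..b, (∫ u in a..x, (x - u) ^ (-β) * p u) *
      ∫ v in x..b, (v - x) ^ (β - 1) * q v = ∫ x, ∫ z, H x z := by
    have e : ∀ x, ∫ z, H x z = (∫ u, k₁ x u) * ∫ v, k₂ x v := fun x => integral_prod_mul _ _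
    simp_rw [e]
    rw [intervalIntegral.integral_of_le hab,
      ← setIntegral_eq_integral_of_forall_compl_eq_zero (s := Set.Ioc a b)
        (f := fun x => (∫ u, k₁ x u) * ∫ v, k₂ x v)]
    · refine setIntegral_congr_fun measurableSet_Ioc fun x hx => ?_
      simp only [k₁, k₂]
      rw [integral_indicator measurableSet_Ioc, integral_indicator measurableSet_Ioc,
        intervalIntegral.integral_of_le hx.1.le, intervalIntegral.integral_of_le hx.2]
    · intro x hx
      rw [Set.mem_Ioc, not_and_or, not_lt, not_le] at hx
      rcases hx with hx | hx
      · simp [k₁, Set.Ioc_eq_empty hx.not_gt]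
      · simp [k₂, Set.Ioc_eq_empty hx.not_gt]
  have hinner : ∀ z, ∫ x, H x z = W z * B := fun z => by
    rw [hk, integral_const_mul]
    by_cases hz : z.1 < z.2
    · rw [hkerI z hz]
    · simp [hW0 z hz]
  rw [hlhs, integral_integral_swap hint]
  simp_rw [hinner]
  rw [integral_mul_const, mul_comm, Measure.volume_eq_prod, integral_prod _ hWi]
  congr 1
  rw [intervalIntegral.integral_of_le hab,
    ← setIntegral_eq_integral_of_forall_compl_eq_zero (s := Set.Ioc a b)
      (f := fun u => ∫ v, W (u, v))]
  · refine setIntegral_congr_fun measurableSet_Ioc fun u hu => ?_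
    rw [intervalIntegral.integral_of_le hu.2, ← integral_const_mul,
      ← integral_indicator measurableSet_Ioc]
    congr 1
    ext v
    simp [W, Set.indicator_apply, hu.1]
  · intro u hu
    have : ∀ v, W (u, v) = 0 := fun v => by
      simp only [W]
      rw [if_neg]
      exact fun h => hu ⟨h.1, h.2.1.le.trans h.2.2⟩
    simp [this]

/-- Both fractional derivatives become fractional integrals, and the minus sign of the right one
cancels that of `glsIntegral`. The result contains values of `g` only, which allows passing to
Hölder integrators. -/
theorem glsIntegral_eq_of_hasDerivAt {f p g q : ℝ → ℝ} {L L' β a b : ℝ}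
    (hf : ∀ x, HasDerivAt f (p x) x) (hpc : Continuous p) (hp : ∀ x, |p x| ≤ L) (hfa : f a = 0)
    (hg : ∀ x, HasDerivAt g (q x) x) (hqc : Continuous q) (hq : ∀ x, |q x| ≤ L')
    (hβ : 0 < β) (hβ1 : β < 1) (hab : a ≤ b) :
    glsIntegral β f g a b = ∫ u in a..b, p u * (g b - g u) := by
  have hG1 := (Real.Gamma_pos_of_pos (show 0 < 1 - β by linarith)).ne'
  have hG2 := (Real.Gamma_pos_of_pos hβ).ne'
  have e : glsIntegral β f g a b = 1 / Real.Gamma (1 - β) * (1 / Real.Gamma β) *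
      ∫ x in a..b, (∫ u in a..x, (x - u) ^ (-β) * p u) *
        ∫ v in x..b, (v - x) ^ (β - 1) * q v := by
    rw [glsIntegral, ← intervalIntegral.integral_neg, ← intervalIntegral.integral_const_mul]
    refine intervalIntegral.integral_congr fun x hx => ?_
    rw [Set.uIcc_of_le hab] at hx
    rw [leftFracDeriv_eq_of_hasDerivAt hf hpc hp hβ hβ1 hfa hx.1,
      rightFracDeriv_eq_of_hasDerivAt hg hqc hq (by linarith) (by linarith) hx.2]
    simp only [sub_sub_cancel, neg_sub]
    ring
  rw [e, integral_fracIntegral_mul_fracIntegral hpc hp hqc hq hβ hβ1 hab]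
  field_simp
  refine intervalIntegral.integral_congr fun u _ => ?_
  rw [intervalIntegral.integral_eq_sub_of_hasDerivAt (fun x _ => hg x)
    (hqc.intervalIntegrable _ _)]

/-! ### Hölder integrators -/

theorem tendsto_rightFracDeriv {g : ℝ → ℝ} {G : ℕ → ℝ → ℝ} {C α β b x : ℝ}
    (hG : ∀ n x y, |G n x - G n y| ≤ C * |x - y| ^ α)
    (hlim : ∀ x, Tendsto (fun n => G n x) atTop (𝓝 (g x)))
    (hα : β < α) (hβ : 0 < β) (hxb : x ≤ b) :
    Tendsto (fun n => rightFracDeriv b β (fun y => G n y - G n b) x) atTop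
      (𝓝 (rightFracDeriv b β (fun y => g y - g b) x)) := by
  simp_rw [rightFracDeriv_eq_leftFracDeriv_neg]
  unfold leftFracDeriv
  have hG' : ∀ n x y, |(G n (-x) - G n b) - (G n (-y) - G n b)| ≤ C * |x - y| ^ α :=
    fun n => holder_comp_neg (hG n) (G n b)
  have hlim' : ∀ x, Tendsto (fun n => G n (-x) - G n b) atTop (𝓝 (g (-x) - g b)) :=
    fun x => (hlim _).sub (hlim _)
  refine (((hlim' _).div_const _).add (Tendsto.const_mul β ?_)).const_mul _
  refine intervalIntegral.tendsto_integral_filter_of_dominated_convergence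
    (fun u => C * (-x - u) ^ (α - β - 1)) ?_ ?_
    ((intervalIntegrable_sub_rpow (by linarith) _ _).const_mul C) ?_
  · refine Eventually.of_forall fun n => ?_
    have h := (intervalIntegrable_holder_kernel (hG' n) hα hβ (neg_le_neg hxb)).aestronglyMeasurable
    rwa [Set.uIoc_of_le (neg_le_neg hxb)]
  · refine Eventually.of_forall fun n => Eventually.of_forall fun u hu => ?_
    rw [Set.uIoc_of_le (neg_le_neg hxb)] at hu
    exact norm_holder_kernel_le (hG' n) hu.2
  · exact Eventually.of_forall fun u _ => ((hlim' _).sub (hlim' _)).div_const _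

/-- Averages of a Hölder function over short intervals to the right of a point. -/
noncomputable def steklovMean (g : ℝ → ℝ) (n : ℕ) (x : ℝ) : ℝ :=
  ((n : ℝ) + 1) * ∫ s in (0 : ℝ)..1 / ((n : ℝ) + 1), g (x + s)

theorem steklovMean_sub_le {g : ℝ → ℝ} (hg : Continuous g) (n : ℕ) {x y K : ℝ}
    (h : ∀ s ∈ Set.Ioc (0 : ℝ) (1 / ((n : ℝ) + 1)), |g (x + s) - y| ≤ K) :
    |steklovMean g n x - y| ≤ K := by
  have hn : (0 : ℝ) < (n : ℝ) + 1 := by positivity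
  have e : steklovMean g n x - y =
      ((n : ℝ) + 1) * ∫ s in (0 : ℝ)..1 / ((n : ℝ) + 1), (g (x + s) - y) := by
    have hi : Continuous fun s => g (x + s) := by fun_prop
    rw [intervalIntegral.integral_sub (hi.intervalIntegrable _ _)
      (continuous_const.intervalIntegrable _ _), steklovMean,
      intervalIntegral.integral_const, smul_eq_mul, sub_zero, mul_sub]
    field_simp
  have h2 := intervalIntegral.norm_integral_le_of_norm_le_const (C := K)
    (f := fun s => g (x + s) - y) (a := 0) (b := 1 / ((n : ℝ) + 1)) (fun s hs => by
      rw [Set.uIoc_of_le (by positivity)] at hs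
      exact h s hs)
  rw [e, abs_mul, abs_of_pos hn]
  rw [sub_zero, abs_of_pos (by positivity)] at h2
  calc _ ≤ ((n : ℝ) + 1) * (K * (1 / ((n : ℝ) + 1))) := mul_le_mul_of_nonneg_left h2 hn.le
    _ = K := by field_simp

/-- Averaging translates of `g` keeps the Hölder constant, uniformly in `n`. -/
theorem steklovMean_holder {g : ℝ → ℝ} {C α : ℝ} (hα : 0 < α)
    (hg : ∀ x y, |g x - g y| ≤ C * |x - y| ^ α) (n : ℕ) (x y : ℝ) :
    |steklovMean g n x - steklovMean g n y| ≤ C * |x - y| ^ α := by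
  have hgc := continuous_of_holder hα hg
  have e : steklovMean g n x - steklovMean g n y =
      steklovMean (fun s => g (x + s) - g (y + s)) n 0 - 0 := by
    simp only [steklovMean, zero_add, sub_zero]
    have hi : ∀ x, Continuous fun s => g (x + s) := fun x => by fun_prop
    rw [intervalIntegral.integral_sub ((hi x).intervalIntegrable _ _)
      ((hi y).intervalIntegrable _ _), mul_sub]
  rw [e]
  refine steklovMean_sub_le (by fun_prop) n fun s _ => ?_
  have h := hg (x + (0 + s)) (y + (0 + s))
  rwa [add_sub_add_right_eq_sub, ← sub_zero (g _ - g _)] at h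

theorem tendsto_steklovMean {g : ℝ → ℝ} {C α : ℝ} (hα : 0 < α)
    (hg : ∀ x y, |g x - g y| ≤ C * |x - y| ^ α) (x : ℝ) :
    Tendsto (fun n => steklovMean g n x) atTop (𝓝 (g x)) := by
  rw [tendsto_iff_norm_sub_tendsto_zero]
  have hC := nonneg_of_holder hg
  have h0 : Tendsto (fun n : ℕ => C * (1 / ((n : ℝ) + 1)) ^ α) atTop (𝓝 0) := by
    have := (tendsto_one_div_add_atTop_nhds_zero_nat (𝕜 := ℝ)).rpow_const (p := α) (Or.inr hα.le)
    simpa [Real.zero_rpow hα.ne'] using this.const_mul C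
  refine squeeze_zero (fun _ => norm_nonneg _) (fun n => ?_) h0
  refine steklovMean_sub_le (continuous_of_holder hα hg) n fun s hs => (hg _ _).trans ?_
  rw [add_sub_cancel_left, abs_of_pos hs.1]
  exact mul_le_mul_of_nonneg_left (Real.rpow_le_rpow hs.1.le hs.2 hα.le) hC

theorem hasDerivAt_steklovMean {g : ℝ → ℝ} (hg : Continuous g) (n : ℕ) (x : ℝ) :
    HasDerivAt (steklovMean g n) (((n : ℝ) + 1) * (g (x + 1 / ((n : ℝ) + 1)) - g x)) x := by
  have e : steklovMean g n = fun x => ((n : ℝ) + 1) *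
      ((∫ s in (0 : ℝ)..x + 1 / ((n : ℝ) + 1), g s) - ∫ s in (0 : ℝ)..x, g s) := by
    ext x
    rw [steklovMean, intervalIntegral.integral_comp_add_left, add_zero,
      intervalIntegral.integral_interval_sub_left (hg.intervalIntegrable _ _)
        (hg.intervalIntegrable _ _)]
  rw [e]
  have h : ∀ y, HasDerivAt (fun x => ∫ s in (0 : ℝ)..x, g s) (g y) y := fun y =>
    intervalIntegral.integral_hasDerivAt_right (hg.intervalIntegrable _ _)
      (hg.stronglyMeasurableAtFilter _ _) hg.continuousAt
  exact (((h (x + 1 / ((n : ℝ) + 1))).comp_add_const x _).sub (h x)).const_mul _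

/-- Apply the smooth formula to the Steklov means of `g` and let `n` tend to infinity on both sides
by dominated convergence. Derivatives of the means may blow up, but neither majorant uses them. -/
theorem glsIntegral_eq_of_holder {f p g : ℝ → ℝ} {L C α β a b : ℝ}
    (hf : ∀ x, HasDerivAt f (p x) x) (hpc : Continuous p) (hp : ∀ x, |p x| ≤ L) (hfa : f a = 0)
    (hg : ∀ x y, |g x - g y| ≤ C * |x - y| ^ α)
    (hβ : 0 < β) (hβ1 : β < 1) (hα : 1 - β < α) (hab : a ≤ b) :
    glsIntegral β f g a b = ∫ u in a..b, p u * (g b - g u) := by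
  have hα0 : 0 < α := lt_trans (by linarith) hα
  have hgc := continuous_of_holder hα0 hg
  have hC := nonneg_of_holder hg
  have hlip := lipschitz_of_hasDerivAt hf hp
  have hG := steklovMean_holder hα0 hg
  have hlim := tendsto_steklovMean hα0 hg
  have heq : ∀ n : ℕ, glsIntegral β f (steklovMean g n) a b =
      ∫ u in a..b, p u * (steklovMean g n b - steklovMean g n u) := fun n =>
    glsIntegral_eq_of_hasDerivAt (L' := ((n : ℝ) + 1) * (C * (1 / ((n : ℝ) + 1)) ^ α))
      hf hpc hp hfa (hasDerivAt_steklovMean hgc n) (by fun_prop) (fun x => by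
        rw [abs_mul, abs_of_pos (by positivity : (0 : ℝ) < (n : ℝ) + 1)]
        refine mul_le_mul_of_nonneg_left ((hg _ _).trans (le_of_eq ?_)) (by positivity)
        rw [add_sub_cancel_left, abs_of_pos (by positivity)]) hβ hβ1 hab
  obtain ⟨K, hK⟩ := exists_bound_leftFracDeriv (C := L) (a := a) (b := b) hβ1 hβ
  obtain ⟨K', hK'⟩ := exists_bound_leftFracDeriv (C := C) (a := -b) (b := -a + 1) hα (by linarith)
  have hGm : ∀ n, Measurable (rightFracDeriv b (1 - β)
      fun y => steklovMean g n y - steklovMean g n b) := fun n => by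
    have e : rightFracDeriv b (1 - β) (fun y => steklovMean g n y - steklovMean g n b) = fun x =>
        leftFracDeriv (-b) (1 - β) (fun y => steklovMean g n (-y) - steklovMean g n b) (-x) := by
      ext x; exact rightFracDeriv_eq_leftFracDeriv_neg _ _ _ _
    rw [e]
    exact (measurable_leftFracDeriv (continuous_of_holder hα0
      (holder_comp_neg (hG n) _)).measurable _ _).comp measurable_neg
  have hfm := measurable_leftFracDeriv (continuous_of_holder one_pos hlip).measurable a β
  -- The uniform bound on the reflected derivative excludes the point `x = b`.
  have hne : ∀ᵐ x : ℝ, x ≠ b := by simp [ae_iff, measure_singleton]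
  have h1 : Tendsto (fun n => glsIntegral β f (steklovMean g n) a b) atTop
      (𝓝 (glsIntegral β f g a b)) := by
    refine Tendsto.neg (intervalIntegral.tendsto_integral_filter_of_dominated_convergence
      (fun _ => K * K') (Eventually.of_forall fun n => ?_) (Eventually.of_forall fun n => ?_)
      (by simp) ?_)
    · exact (hfm.mul (hGm n)).aestronglyMeasurable
    · filter_upwards [hne] with x hxb hx
      rw [Set.uIoc_of_le hab] at hx
      have hx' : x < b := lt_of_le_of_ne hx.2 hxb
      rw [norm_mul, rightFracDeriv_eq_leftFracDeriv_neg]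
      have h := hK f hlip hfa x hx
      exact mul_le_mul h (hK' _ (holder_comp_neg (hG n) _) (by simp) (-x)
        ⟨by linarith, by linarith [hx.1]⟩) (norm_nonneg _) ((abs_nonneg _).trans h)
    · refine Eventually.of_forall fun x hx => ?_
      rw [Set.uIoc_of_le hab] at hx
      exact (tendsto_rightFracDeriv hG hlim hα (by linarith) hx.2).const_mul _
  have h2 : Tendsto (fun n => ∫ u in a..b, p u * (steklovMean g n b - steklovMean g n u)) atTop
      (𝓝 (∫ u in a..b, p u * (g b - g u))) := by
    refine intervalIntegral.tendsto_integral_filter_of_dominated_convergence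
      (fun _ => L * (C * (b - a) ^ α)) (Eventually.of_forall fun n => ?_)
      (Eventually.of_forall fun n => Eventually.of_forall fun x hx => ?_) (by simp) ?_
    · have := continuous_of_holder hα0 (hG n)
      exact Continuous.aestronglyMeasurable (by fun_prop)
    · rw [Set.uIoc_of_le hab] at hx
      rw [norm_mul]
      refine mul_le_mul (hp x) ((hG n b x).trans ?_) (norm_nonneg _) ((abs_nonneg _).trans (hp x))
      rw [abs_of_nonneg (sub_nonneg.2 hx.2)]
      exact mul_le_mul_of_nonneg_left (Real.rpow_le_rpow (sub_nonneg.2 hx.2)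
        (by linarith [hx.1]) hα0.le) hC
    · exact Eventually.of_forall fun x _ => ((hlim b).sub (hlim x)).const_mul _
  simp_rw [heq] at h1
  exact tendsto_nhds_unique h1 h2


/-! ### Locality of the integral -/

theorem leftFracDeriv_congr {f f' : ℝ → ℝ} {a b β x : ℝ} (h : Set.EqOn f f' (Set.Icc a b))
    (hx : x ∈ Set.Icc a b) : leftFracDeriv a β f x = leftFracDeriv a β f' x := by
  unfold leftFracDeriv
  rw [h hx, intervalIntegral.integral_congr (g := fun u => (f' x - f' u) / (x - u) ^ (β + 1))]
  intro u hu
  rw [Set.uIcc_of_le hx.1] at hu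
  simp only [h ⟨hu.1, hu.2.trans hx.2⟩]

theorem rightFracDeriv_congr {g g' : ℝ → ℝ} {a b β x : ℝ} (h : Set.EqOn g g' (Set.Icc a b))
    (hx : x ∈ Set.Icc a b) : rightFracDeriv b β g x = rightFracDeriv b β g' x := by
  unfold rightFracDeriv
  rw [h hx, intervalIntegral.integral_congr (g := fun u => (g' x - g' u) / (u - x) ^ (β + 1))]
  intro u hu
  rw [Set.uIcc_of_le hx.2] at hu
  simp only [h ⟨hx.1.trans hu.1, hu.2⟩]

theorem eqOn_sub_const_of_eqOn {g g' : ℝ → ℝ} {a b : ℝ} (h : Set.EqOn g g' (Set.Icc a b))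
    (hab : a ≤ b) : Set.EqOn (fun x => g x - g b) (fun x => g' x - g' b) (Set.Icc a b) :=
  fun x hx => by simp only [h hx, h (Set.right_mem_Icc.2 hab)]

/-- On `[a, b]` the fractional derivatives see only values on `[a, b]`, so the strategy may be
replaced by a finite sum and the path by its clamped version. -/
theorem glsIntegral_congr {f f' g g' : ℝ → ℝ} {a b : ℝ} (β : ℝ) (hf : Set.EqOn f f' (Set.Icc a b))
    (hg : Set.EqOn g g' (Set.Icc a b)) (hab : a ≤ b) :
    glsIntegral β f g a b = glsIntegral β f' g' a b := by
  unfold glsIntegral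
  congr 1
  refine intervalIntegral.integral_congr fun x hx => ?_
  rw [Set.uIcc_of_le hab] at hx
  rw [leftFracDeriv_congr hf hx, rightFracDeriv_congr (eqOn_sub_const_of_eqOn hg hab) hx]

theorem GLSIntegrable.congr {f f' g g' : ℝ → ℝ} {a b β : ℝ} (h : GLSIntegrable β f' g' a b)
    (hf : Set.EqOn f f' (Set.Icc a b)) (hg : Set.EqOn g g' (Set.Icc a b)) (hab : a ≤ b) :
    GLSIntegrable β f g a b where
  norm_lt_top := by
    refine lt_of_eq_of_lt ?_ h.norm_lt_top
    unfold glsNorm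
    refine setLIntegral_congr_fun measurableSet_Ioc fun t ht => ?_
    have ht' := Set.Ioc_subset_Icc_self ht
    rw [hf ht']
    congr 1
    refine setLIntegral_congr_fun measurableSet_Ioc fun s hs => ?_
    rw [hf ⟨hs.1.le, hs.2.trans ht.2⟩]
  left_inner := by
    filter_upwards [h.left_inner, ae_restrict_mem measurableSet_Ioc] with x hx hxm
    refine hx.congr fun u hu => ?_
    rw [Set.uIoc_of_le hxm.1.le] at hu
    simp only [hf (Set.Ioc_subset_Icc_self hxm), hf ⟨hu.1.le, hu.2.trans hxm.2⟩]
  left_memLp := by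
    refine (memLp_congr_ae ?_).1 h.left_memLp
    filter_upwards [ae_restrict_mem measurableSet_Ioc] with x hx
    exact (leftFracDeriv_congr hf (Set.Ioc_subset_Icc_self hx)).symm
  right_inner := by
    filter_upwards [h.right_inner, ae_restrict_mem measurableSet_Ioc] with x hx hxm
    refine hx.congr fun u hu => ?_
    rw [Set.uIoc_of_le hxm.2] at hu
    simp only [hg (Set.Ioc_subset_Icc_self hxm), hg ⟨hxm.1.le.trans hu.1.le, hu.2⟩]
  right_memLp := by
    refine (memLp_congr_ae ?_).1 h.right_memLp
    filter_upwards [ae_restrict_mem measurableSet_Ioc] with x hx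
    exact (rightFracDeriv_congr (eqOn_sub_const_of_eqOn hg hab)
      (Set.Ioc_subset_Icc_self hx)).symm

/-! ### Smooth steps -/

/-- A smooth monotone function rising from `0` to `1` on `[r, r + θ]`. -/
noncomputable def smoothStep (r θ t : ℝ) : ℝ := Real.smoothTransition ((t - r) / θ)

/-- The derivative of `smoothStep`. -/
noncomputable def smoothStepDeriv (r θ t : ℝ) : ℝ := deriv Real.smoothTransition ((t - r) / θ) / θ

theorem contDiff_one_smoothTransition : ContDiff ℝ 1 Real.smoothTransition :=
  Real.smoothTransition.contDiff (n := 1)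

theorem hasDerivAt_smoothStep (r θ t : ℝ) :
    HasDerivAt (smoothStep r θ) (smoothStepDeriv r θ t) t := by
  have h1 : HasDerivAt (fun t : ℝ => (t - r) / θ) (1 / θ) t :=
    ((hasDerivAt_id t).sub_const r).div_const θ
  have h2 := (contDiff_one_smoothTransition.differentiable one_ne_zero
    ((t - r) / θ)).hasDerivAt
  refine (h2.comp t h1).congr_deriv ?_
  rw [smoothStepDeriv, mul_one_div]

theorem continuous_smoothStepDeriv (r θ : ℝ) : Continuous (smoothStepDeriv r θ) := by
  have := contDiff_one_smoothTransition.continuous_deriv le_rfl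
  unfold smoothStepDeriv
  fun_prop

theorem smoothStep_of_le {r θ t : ℝ} (hθ : 0 < θ) (h : t ≤ r) : smoothStep r θ t = 0 :=
  Real.smoothTransition.zero_of_nonpos (div_nonpos_of_nonpos_of_nonneg (by linarith) hθ.le)

theorem deriv_smoothTransition_eq_zero {y : ℝ} (hy : y ∉ Set.Icc (0 : ℝ) 1) :
    deriv Real.smoothTransition y = 0 := by
  rw [Set.mem_Icc, not_and_or, not_le, not_le] at hy
  rcases hy with hy | hy
  · have : Real.smoothTransition =ᶠ[𝓝 y] fun _ => 0 := by
      filter_upwards [Iio_mem_nhds hy] with z hz using Real.smoothTransition.zero_of_nonpos hz.le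
    rw [this.deriv_eq, deriv_const]
  · have : Real.smoothTransition =ᶠ[𝓝 y] fun _ => 1 := by
      filter_upwards [Ioi_mem_nhds hy] with z hz using Real.smoothTransition.one_of_one_le hz.le
    rw [this.deriv_eq, deriv_const]

theorem exists_bound_smoothStepDeriv (r θ : ℝ) : ∃ L, ∀ t, |smoothStepDeriv r θ t| ≤ L := by
  have hc := contDiff_one_smoothTransition.continuous_deriv le_rfl
  obtain ⟨B, hB⟩ := isCompact_Icc.exists_bound_of_continuousOn (hc.continuousOn (s := Set.Icc 0 1))
  refine ⟨max B 0 / |θ|, fun t => ?_⟩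
  rw [smoothStepDeriv, abs_div]
  gcongr
  by_cases h : (t - r) / θ ∈ Set.Icc (0 : ℝ) 1
  · exact (hB _ h).trans (le_max_left _ _)
  · rw [deriv_smoothTransition_eq_zero h, abs_zero]
    exact le_max_right _ _

theorem smoothStepDeriv_nonneg {r θ : ℝ} (hθ : 0 < θ) (t : ℝ) : 0 ≤ smoothStepDeriv r θ t :=
  div_nonneg Real.smoothTransition.monotone.deriv_nonneg hθ.le

theorem smoothStepDeriv_eq_zero {r θ t : ℝ} (hθ : 0 < θ) (h : t ∉ Set.Icc r (r + θ)) :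
    smoothStepDeriv r θ t = 0 := by
  rw [smoothStepDeriv, deriv_smoothTransition_eq_zero, zero_div]
  contrapose! h
  rw [Set.mem_Icc, div_nonneg_iff, div_le_one hθ] at h
  constructor
  · rcases h.1 with h' | h' <;> linarith [h'.1, h'.2]
  · linarith [h.2]

/-- The weight is a probability density on `[r, r + θ]`, so averaging costs at most the oscillation
`C θ^α` of `g`. If `t` falls inside this window part of the mass is missing, but then `g t - g r` is
itself that small. The bound thus holds for every `t ≥ 0`. -/
theorem abs_integral_smoothStepDeriv_sub_le {g : ℝ → ℝ} {C α r θ t : ℝ} (hα : 0 < α)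
    (hg : ∀ x y, |g x - g y| ≤ C * |x - y| ^ α) (hr : 0 ≤ r) (hθ : 0 < θ) (ht : 0 ≤ t) :
    |(∫ u in (0 : ℝ)..t, smoothStepDeriv r θ u * (g t - g u)) - (g t - g (min r t))| ≤
      2 * (C * θ ^ α) := by
  have hC := nonneg_of_holder hg
  have hgc := continuous_of_holder hα hg
  have hsc := continuous_smoothStepDeriv r θ
  have hnear : ∀ x y, |x - y| ≤ θ → |g x - g y| ≤ C * θ ^ α := fun x y h =>
    (hg x y).trans (mul_le_mul_of_nonneg_left (Real.rpow_le_rpow (abs_nonneg _) h hα.le) hC)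
  have hint : ∫ u in (0 : ℝ)..t, smoothStepDeriv r θ u = smoothStep r θ t := by
    rw [intervalIntegral.integral_eq_sub_of_hasDerivAt (fun u _ => hasDerivAt_smoothStep r θ u)
      (hsc.intervalIntegrable _ _), smoothStep_of_le hθ hr, sub_zero]
  have hs0 : 0 ≤ smoothStep r θ t := Real.smoothTransition.nonneg _
  have hs1 : smoothStep r θ t ≤ 1 := Real.smoothTransition.le_one _
  have hnn : 0 ≤ C * θ ^ α := mul_nonneg hC (Real.rpow_nonneg hθ.le _)
  have e : (∫ u in (0 : ℝ)..t, smoothStepDeriv r θ u * (g t - g u)) - (g t - g (min r t)) =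
      (∫ u in (0 : ℝ)..t, smoothStepDeriv r θ u * (g (min r t) - g u)) +
        (smoothStep r θ t - 1) * (g t - g (min r t)) := by
    have e2 : ∀ u, smoothStepDeriv r θ u * (g t - g u) =
        smoothStepDeriv r θ u * (g (min r t) - g u) +
          smoothStepDeriv r θ u * (g t - g (min r t)) := fun u => by ring
    simp_rw [e2]
    rw [intervalIntegral.integral_add (Continuous.intervalIntegrable (by fun_prop) _ _)
      (Continuous.intervalIntegrable (by fun_prop) _ _), intervalIntegral.integral_mul_const, hint]
    ring
  rw [e, two_mul]
  refine (abs_add_le _ _).trans (add_le_add ?_ ?_)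
  · have h := intervalIntegral.norm_integral_le_of_norm_le (μ := volume) ht
      (f := fun u => smoothStepDeriv r θ u * (g (min r t) - g u))
      (g := fun u => smoothStepDeriv r θ u * (C * θ ^ α)) (Eventually.of_forall fun u hu => ?_)
      (Continuous.intervalIntegrable (by fun_prop) _ _)
    · rw [intervalIntegral.integral_mul_const, hint] at h
      exact h.trans (mul_le_of_le_one_left hnn hs1)
    · rw [norm_mul, Real.norm_of_nonneg (smoothStepDeriv_nonneg hθ u)]
      by_cases hur : u ∈ Set.Icc r (r + θ)
      · refine mul_le_mul_of_nonneg_left (hnear _ _ ?_) (smoothStepDeriv_nonneg hθ u)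
        rw [min_eq_left (hur.1.trans hu.2), abs_sub_comm, abs_of_nonneg (by linarith [hur.1])]
        linarith [hur.2]
      · simp [smoothStepDeriv_eq_zero hθ hur]
  · rcases le_total t r with htr | htr
    · simpa [min_eq_right htr] using hnn
    rw [min_eq_left htr]
    rcases le_total (r + θ) t with h | h
    · have : smoothStep r θ t = 1 := Real.smoothTransition.one_of_one_le (by
        rw [le_div_iff₀ hθ]; linarith)
      simpa [this] using hnn
    · rw [abs_mul]
      refine (mul_le_of_le_one_left (abs_nonneg _) ?_).trans (hnear _ _ ?_)
      · rw [abs_le]; constructor <;> linarith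
      · rw [abs_of_nonneg (by linarith)]; linarith

/-! ### Stopped quadratic strategies on a grid -/

/-- The position held after observing `x 0, …, x k`: proportional to `x k - x 0` until the first
time `|x j - x 0|` reaches the level `ε`, and zero afterwards. -/
noncomputable def stoppedPosition (x : ℕ → ℝ) (ε : ℝ) (k : ℕ) : ℝ :=
  open Classical in if ∀ j ≤ k, |x j - x 0| < ε then 2 / ε ^ 2 * (x k - x 0) else 0

theorem abs_stoppedPosition_le (x : ℕ → ℝ) {ε : ℝ} (hε : 0 < ε) (k : ℕ) :
    |stoppedPosition x ε k| ≤ 2 / ε := by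
  unfold stoppedPosition
  split_ifs with h
  · rw [abs_mul, abs_of_pos (by positivity)]
    calc 2 / ε ^ 2 * |x k - x 0| ≤ 2 / ε ^ 2 * ε := by gcongr; exact (h k le_rfl).le
      _ = 2 / ε := by field_simp
  · rw [abs_zero]; positivity

theorem stoppedPosition_congr {x y : ℕ → ℝ} {k : ℕ} (ε : ℝ) (h : ∀ j ≤ k, x j = y j) :
    stoppedPosition x ε k = stoppedPosition y ε k := by
  unfold stoppedPosition
  have : (∀ j ≤ k, |x j - x 0| < ε) ↔ ∀ j ≤ k, |y j - y 0| < ε :=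
    forall₂_congr fun j hj => by rw [h j hj, h 0 (Nat.zero_le k)]
  simp only [this]
  rw [h k le_rfl, h 0 (Nat.zero_le k)]

/-- While active, each step gains the increase of `(y_k - y_0)²/ε²` minus at most `D²/ε²`. At the
step that reaches the level the square is at least `ε²`, so 1 is secured, and the position is zero
afterwards. -/
theorem sum_stoppedPosition_mul_sub_ge {y : ℕ → ℝ} {ε D : ℝ} (hε : 0 < ε) (n : ℕ)
    (hD : ∀ k < n, |y (k + 1) - y k| ≤ D) :
    (if ∀ j ≤ n, |y j - y 0| < ε then (y n - y 0) ^ 2 / ε ^ 2 else 1) - n * D ^ 2 / ε ^ 2 ≤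
      ∑ k ∈ Finset.range n, stoppedPosition y ε k * (y (k + 1) - y k) := by
  classical
  induction n with
  | zero => simp [hε]
  | succ n ih =>
    have ih := ih fun k hk => hD k (hk.trans n.lt_succ_self)
    rw [Finset.sum_range_succ]
    have hdn := hD n n.lt_succ_self
    have hsq : (y (n + 1) - y n) ^ 2 ≤ D ^ 2 := sq_le_sq' (by linarith [(abs_le.1 hdn).1])
      (abs_le.1 hdn).2
    have hε2 : 0 < ε ^ 2 := by positivity
    push_cast
    by_cases hn : ∀ j ≤ n, |y j - y 0| < ε
    · rw [if_pos hn] at ih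
      have e : stoppedPosition y ε n * (y (n + 1) - y n) = (y (n + 1) - y 0) ^ 2 / ε ^ 2 -
          (y n - y 0) ^ 2 / ε ^ 2 - (y (n + 1) - y n) ^ 2 / ε ^ 2 := by
        rw [stoppedPosition, if_pos hn]
        field_simp
        ring
      have h3 : (y (n + 1) - y n) ^ 2 / ε ^ 2 ≤ D ^ 2 / ε ^ 2 := by gcongr
      have h4 : ((n : ℝ) + 1) * D ^ 2 / ε ^ 2 = n * D ^ 2 / ε ^ 2 + D ^ 2 / ε ^ 2 := by ring
      have h5 : (if ∀ j ≤ n + 1, |y j - y 0| < ε then (y (n + 1) - y 0) ^ 2 / ε ^ 2 else 1) ≤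
          (y (n + 1) - y 0) ^ 2 / ε ^ 2 := by
        split_ifs with h
        · exact le_rfl
        · have : ε ≤ |y (n + 1) - y 0| := by
            by_contra hlt
            refine h fun j hj => ?_
            rcases Nat.le_succ_iff.1 hj with hj | rfl
            · exact hn j hj
            · exact not_le.1 hlt
          rw [one_le_div hε2, ← sq_abs (y (n + 1) - y 0)]
          gcongr
      rw [e, h4]
      linarith
    · have hn' : ¬ ∀ j ≤ n + 1, |y j - y 0| < ε := fun h => hn fun j hj => h j (by omega)
      rw [if_neg hn] at ih
      rw [if_neg hn', stoppedPosition, if_neg hn, zero_mul, add_zero]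
      refine le_trans ?_ ih
      gcongr
      linarith


/-- The stopped quadratic strategy on the grid `s 0, …, s N`, with positions changed smoothly during
time `θ` after each grid point. -/
noncomputable def blockStrategy (x : ℝ → ℝ) (s : ℕ → ℝ) (ε θ : ℝ) (N : ℕ) (t : ℝ) : ℝ :=
  ∑ k ∈ Finset.range N, stoppedPosition (fun j => x (s j)) ε k *
    (smoothStep (s k) θ t - smoothStep (s (k + 1)) θ t)

/-- The derivative of `blockStrategy`. -/
noncomputable def blockStrategyDeriv (x : ℝ → ℝ) (s : ℕ → ℝ) (ε θ : ℝ) (N : ℕ) (t : ℝ) : ℝ :=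
  ∑ k ∈ Finset.range N, stoppedPosition (fun j => x (s j)) ε k *
    (smoothStepDeriv (s k) θ t - smoothStepDeriv (s (k + 1)) θ t)

theorem exists_bound_sum {ι : Type*} (S : Finset ι) {F : ι → ℝ → ℝ}
    (h : ∀ i ∈ S, ∃ L, ∀ t, |F i t| ≤ L) : ∃ L, ∀ t, |∑ i ∈ S, F i t| ≤ L := by
  choose! L hL using h
  exact ⟨∑ i ∈ S, L i, fun t => (Finset.abs_sum_le_sum_abs _ _).trans
    (Finset.sum_le_sum fun i hi => hL i hi t)⟩

theorem hasDerivAt_blockStrategy (x : ℝ → ℝ) (s : ℕ → ℝ) (ε θ : ℝ) (N : ℕ) (t : ℝ) :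
    HasDerivAt (blockStrategy x s ε θ N) (blockStrategyDeriv x s ε θ N t) t :=
  HasDerivAt.fun_sum fun _ _ =>
    ((hasDerivAt_smoothStep _ _ t).sub (hasDerivAt_smoothStep _ _ t)).const_mul _

theorem continuous_blockStrategyDeriv (x : ℝ → ℝ) (s : ℕ → ℝ) (ε θ : ℝ) (N : ℕ) :
    Continuous (blockStrategyDeriv x s ε θ N) :=
  continuous_finsetSum _ fun _ _ => continuous_const.mul
    ((continuous_smoothStepDeriv _ _).sub (continuous_smoothStepDeriv _ _))

theorem exists_bound_blockStrategyDeriv (x : ℝ → ℝ) (s : ℕ → ℝ) (ε θ : ℝ) (N : ℕ) :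
    ∃ L, ∀ t, |blockStrategyDeriv x s ε θ N t| ≤ L := by
  refine exists_bound_sum _ fun k _ => ?_
  obtain ⟨L₁, h₁⟩ := exists_bound_smoothStepDeriv (s k) θ
  obtain ⟨L₂, h₂⟩ := exists_bound_smoothStepDeriv (s (k + 1)) θ
  refine ⟨|stoppedPosition (fun j => x (s j)) ε k| * (L₁ + L₂), fun t => ?_⟩
  rw [abs_mul]
  exact mul_le_mul_of_nonneg_left ((abs_sub _ _).trans (add_le_add (h₁ t) (h₂ t))) (abs_nonneg _)

theorem blockStrategy_of_le {x : ℝ → ℝ} {s : ℕ → ℝ} {ε θ t : ℝ} {N : ℕ} (hs : Monotone s)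
    (hθ : 0 < θ) (ht : t ≤ s 0) : blockStrategy x s ε θ N t = 0 := by
  refine Finset.sum_eq_zero fun k _ => ?_
  rw [smoothStep_of_le hθ (ht.trans (hs (Nat.zero_le k))),
    smoothStep_of_le hθ (ht.trans (hs (Nat.zero_le (k + 1)))), sub_zero, mul_zero]

/-- If `s k ≤ t`, stopping at `t` does not change the observed values; otherwise the increment is
zero. Hence the discrete estimate applies at any intermediate time `t`. -/
theorem stoppedPosition_mul_stopped_increment {g : ℝ → ℝ} {s : ℕ → ℝ} (hs : Monotone s) (ε t : ℝ)
    (k : ℕ) :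
    stoppedPosition (fun j => g (s j)) ε k * (g (min (s (k + 1)) t) - g (min (s k) t)) =
      stoppedPosition (fun j => g (min (s j) t)) ε k *
        (g (min (s (k + 1)) t) - g (min (s k) t)) := by
  rcases le_total (s k) t with h | h
  · rw [stoppedPosition_congr (y := fun j => g (min (s j) t)) ε fun j hj => ?_]
    rw [min_eq_left ((hs hj).trans h)]
  · rw [min_eq_right h, min_eq_right (h.trans (hs k.le_succ)), sub_self, mul_zero, mul_zero]

/-- The discrete bound is applied to the grid stopped at `t`. Each interval uses two smooth steps
with error `2 C θ^α` each and a position of size at most `2/ε`, whence `8/ε`. -/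
theorem integral_blockStrategyDeriv_ge {g : ℝ → ℝ} {C α : ℝ} (hα : 0 < α)
    (hg : ∀ x y, |g x - g y| ≤ C * |x - y| ^ α) {s : ℕ → ℝ} {h ε θ t : ℝ} {N : ℕ} (hh : 0 ≤ h)
    (hs : ∀ k, s (k + 1) = s k + h) (hs0 : 0 ≤ s 0) (hε : 0 < ε) (hθ : 0 < θ) (ht : 0 ≤ t) :
    (if ∀ j ≤ N, |g (min (s j) t) - g (min (s 0) t)| < ε then 0 else 1) -
        (C ^ 2 * (N * (h ^ α) ^ 2 / ε ^ 2) + C * (N * (8 / ε) * θ ^ α)) ≤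
      ∫ u in (0 : ℝ)..t, blockStrategyDeriv g s ε θ N u * (g t - g u) := by
  have hC := nonneg_of_holder hg
  have hgc := continuous_of_holder hα hg
  have hmono : Monotone s := monotone_nat_of_le_succ fun k => by rw [hs]; linarith
  have hsnn : ∀ k, 0 ≤ s k := fun k => hs0.trans (hmono (Nat.zero_le k))
  have hterm : ∀ k, Continuous fun u => smoothStepDeriv (s k) θ u * (g t - g u) := fun k => by
    have := continuous_smoothStepDeriv (s k) θ
    fun_prop
  have hsum : ∫ u in (0 : ℝ)..t, blockStrategyDeriv g s ε θ N u * (g t - g u) =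
      ∑ k ∈ Finset.range N, stoppedPosition (fun j => g (s j)) ε k *
        ((∫ u in (0 : ℝ)..t, smoothStepDeriv (s k) θ u * (g t - g u)) -
          ∫ u in (0 : ℝ)..t, smoothStepDeriv (s (k + 1)) θ u * (g t - g u)) := by
    have e : ∀ u, blockStrategyDeriv g s ε θ N u * (g t - g u) =
        ∑ k ∈ Finset.range N, stoppedPosition (fun j => g (s j)) ε k *
          (smoothStepDeriv (s k) θ u * (g t - g u) -
            smoothStepDeriv (s (k + 1)) θ u * (g t - g u)) := fun u => by
      rw [blockStrategyDeriv, Finset.sum_mul]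
      exact Finset.sum_congr rfl fun k _ => by ring
    simp_rw [e]
    rw [intervalIntegral.integral_finsetSum fun k _ => (((hterm k).intervalIntegrable _ _).sub
      ((hterm (k + 1)).intervalIntegrable _ _)).const_mul _]
    refine Finset.sum_congr rfl fun k _ => ?_
    rw [intervalIntegral.integral_const_mul, intervalIntegral.integral_sub
      ((hterm k).intervalIntegrable _ _) ((hterm (k + 1)).intervalIntegrable _ _)]
  have hstep : ∀ k, stoppedPosition (fun j => g (min (s j) t)) ε k *
      (g (min (s (k + 1)) t) - g (min (s k) t)) - 2 / ε * (4 * (C * θ ^ α)) ≤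
      stoppedPosition (fun j => g (s j)) ε k *
        ((∫ u in (0 : ℝ)..t, smoothStepDeriv (s k) θ u * (g t - g u)) -
          ∫ u in (0 : ℝ)..t, smoothStepDeriv (s (k + 1)) θ u * (g t - g u)) := fun k => by
    rw [← stoppedPosition_mul_stopped_increment hmono]
    have h1 := abs_integral_smoothStepDeriv_sub_le hα hg (hsnn k) hθ ht
    have h2 := abs_integral_smoothStepDeriv_sub_le hα hg (hsnn (k + 1)) hθ ht
    set I₁ := ∫ u in (0 : ℝ)..t, smoothStepDeriv (s k) θ u * (g t - g u)
    set I₂ := ∫ u in (0 : ℝ)..t, smoothStepDeriv (s (k + 1)) θ u * (g t - g u)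
    have h3 : |(g (min (s (k + 1)) t) - g (min (s k) t)) - (I₁ - I₂)| ≤ 4 * (C * θ ^ α) := by
      rw [abs_le] at h1 h2 ⊢
      constructor <;> linarith [h1.1, h1.2, h2.1, h2.2]
    have h4 := mul_le_mul (abs_stoppedPosition_le (fun j => g (s j)) hε k) h3 (abs_nonneg _)
      (by positivity)
    rw [← abs_mul, mul_sub] at h4
    linarith [(abs_le.1 h4).2]
  have hdisc := sum_stoppedPosition_mul_sub_ge (y := fun j => g (min (s j) t)) (D := C * h ^ α)
    hε N fun k _ => (hg _ _).trans (mul_le_mul_of_nonneg_left (Real.rpow_le_rpow (abs_nonneg _)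
      (by
        have := abs_min_sub_min_le_max (s (k + 1)) t (s k) t
        rw [hs k, add_sub_cancel_left, sub_self, abs_zero, abs_of_nonneg hh, max_eq_left hh] at this
        rw [hs k]
        exact this) hα.le) hC)
  rw [hsum]
  refine le_trans ?_ (Finset.sum_le_sum fun k _ => hstep k)
  rw [Finset.sum_sub_distrib, Finset.sum_const, Finset.card_range, nsmul_eq_mul]
  have e1 : (N : ℝ) * (C * h ^ α) ^ 2 / ε ^ 2 = C ^ 2 * (N * (h ^ α) ^ 2 / ε ^ 2) := by ring
  have e2 : (N : ℝ) * (2 / ε * (4 * (C * θ ^ α))) = C * (N * (8 / ε) * θ ^ α) := by ring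
  rw [e1] at hdisc
  rw [e2]
  -- Before the level is reached the gain is a square and may be dropped.
  have h6 : (if ∀ j ≤ N, |g (min (s j) t) - g (min (s 0) t)| < ε then (0 : ℝ) else 1) ≤
      if ∀ j ≤ N, |g (min (s j) t) - g (min (s 0) t)| < ε then
        (g (min (s N) t) - g (min (s 0) t)) ^ 2 / ε ^ 2 else 1 := by
    split_ifs
    · positivity
    · exact le_rfl
  linarith

/-! ### The strategy on a sequence of grids accumulating at time one -/

/-- Consecutive intervals `[τ n, τ (n + 1)]` exhausting `[τ 0, 1)`, each with an equidistant grid of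
`N n` steps, a level `ε n` and a switching time `θ n`, all fine enough for `α`-Hölder paths. -/
structure GridSequence (α : ℝ) where
  τ : ℕ → ℝ
  N : ℕ → ℕ
  ε : ℕ → ℝ
  θ : ℕ → ℝ
  τ_nonneg : ∀ n, 0 ≤ τ n
  τ_lt_succ : ∀ n, τ n < τ (n + 1)
  τ_lt_one : ∀ n, τ n < 1
  tendsto_τ : Tendsto τ atTop (𝓝 1)
  N_pos : ∀ n, 0 < N n
  ε_pos : ∀ n, 0 < ε n
  θ_pos : ∀ n, 0 < θ n
  mesh_le : ∀ n, ((τ (n + 1) - τ n) / N n) ^ α ≤ (1 / 2) ^ n * ε n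
  sq_le : ∀ n, N n * (((τ (n + 1) - τ n) / N n) ^ α) ^ 2 / ε n ^ 2 ≤ (1 / 2) ^ n
  switch_le : ∀ n, N n * (8 / ε n) * θ n ^ α ≤ (1 / 2) ^ n

namespace GridSequence

variable {α : ℝ} (G : GridSequence α)

/-- The step of the `n`-th grid. -/
noncomputable def mesh (n : ℕ) : ℝ := (G.τ (n + 1) - G.τ n) / G.N n

/-- The points of the `n`-th grid. -/
noncomputable def point (n k : ℕ) : ℝ := G.τ n + k * G.mesh n

/-- The strategy following the path `x`. -/
noncomputable def strategy (x : ℝ → ℝ) (t : ℝ) : ℝ :=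
  ∑' n, blockStrategy x (G.point n) (G.ε n) (G.θ n) (G.N n) t

theorem mesh_pos (n : ℕ) : 0 < G.mesh n :=
  div_pos (sub_pos.2 (G.τ_lt_succ n)) (Nat.cast_pos.2 (G.N_pos n))

theorem point_zero (n : ℕ) : G.point n 0 = G.τ n := by simp [point]

theorem point_succ (n k : ℕ) : G.point n (k + 1) = G.point n k + G.mesh n := by
  simp only [point]; push_cast; ring

theorem point_N (n : ℕ) : G.point n (G.N n) = G.τ (n + 1) := by
  have := (Nat.cast_pos (α := ℝ)).2 (G.N_pos n)
  rw [point, mesh, mul_div_cancel₀ _ this.ne']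
  ring

theorem monotone_point (n : ℕ) : Monotone (G.point n) :=
  monotone_nat_of_le_succ fun k => by rw [point_succ]; linarith [G.mesh_pos n]

theorem strictMono_τ : StrictMono G.τ := strictMono_nat_of_lt_succ G.τ_lt_succ

theorem exists_lt_τ {t : ℝ} (ht : t < 1) : ∃ M, t < G.τ M :=
  (G.tendsto_τ.eventually (lt_mem_nhds ht)).exists

/-- Block `n` is zero up to time `τ n`, so the series is locally finite on `[0, 1)`. -/
theorem strategy_eq_sum (x : ℝ → ℝ) {t : ℝ} {M : ℕ} (ht : t ≤ G.τ M) :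
    G.strategy x t = ∑ n ∈ Finset.range M,
      blockStrategy x (G.point n) (G.ε n) (G.θ n) (G.N n) t := by
  refine tsum_eq_sum fun n hn => blockStrategy_of_le (G.monotone_point n) (G.θ_pos n) ?_
  rw [Finset.mem_range, not_lt] at hn
  rw [point_zero]
  exact ht.trans (G.strictMono_τ.monotone hn)

theorem strategy_zero (x : ℝ → ℝ) : G.strategy x 0 = 0 := by
  rw [G.strategy_eq_sum x (G.τ_nonneg 0), Finset.sum_range_zero]

theorem hasDerivAt_partial (x : ℝ → ℝ) (M : ℕ) (t : ℝ) :
    HasDerivAt (fun t => ∑ n ∈ Finset.range M,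
        blockStrategy x (G.point n) (G.ε n) (G.θ n) (G.N n) t)
      (∑ n ∈ Finset.range M, blockStrategyDeriv x (G.point n) (G.ε n) (G.θ n) (G.N n) t) t :=
  HasDerivAt.fun_sum fun _ _ => hasDerivAt_blockStrategy _ _ _ _ _ t

theorem continuousOn_strategy (x : ℝ → ℝ) : ContinuousOn (G.strategy x) (Set.Iio 1) := by
  intro t ht
  obtain ⟨M, hM⟩ := G.exists_lt_τ ht
  refine ((G.hasDerivAt_partial x M t).continuousAt.congr ?_).continuousWithinAt
  filter_upwards [Iio_mem_nhds hM] with u hu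
  exact (G.strategy_eq_sum x (le_of_lt hu)).symm

theorem glsIntegrable_strategy {x g : ℝ → ℝ} {C β t : ℝ}
    (hg : ∀ x y, |g x - g y| ≤ C * |x - y| ^ α) (hβ : 0 < β) (hβ1 : β < 1) (hα : 1 - β < α)
    (ht0 : 0 ≤ t) (ht : t < 1) : GLSIntegrable β (G.strategy x) g 0 t := by
  obtain ⟨M, hM⟩ := G.exists_lt_τ ht
  obtain ⟨L, hL⟩ := exists_bound_sum (Finset.range M) fun n _ =>
    exists_bound_blockStrategyDeriv x (G.point n) (G.ε n) (G.θ n) (G.N n)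
  have heq : ∀ u ≤ t, G.strategy x u = _ := fun u hu => G.strategy_eq_sum x (hu.trans hM.le)
  refine GLSIntegrable.congr (glsIntegrable_of_holder
    (lipschitz_of_hasDerivAt (G.hasDerivAt_partial x M) hL) hg hβ hβ1 hβ1 hα ?_)
    (fun u hu => heq u hu.2) (fun _ _ => rfl) ht0
  rw [← heq 0 ht0, strategy_zero]

theorem glsIntegral_strategy {x g : ℝ → ℝ} {C β t : ℝ} {M : ℕ}
    (hg : ∀ x y, |g x - g y| ≤ C * |x - y| ^ α) (hβ : 0 < β) (hβ1 : β < 1) (hα : 1 - β < α)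
    (ht0 : 0 ≤ t) (hM : t ≤ G.τ M) :
    glsIntegral β (G.strategy x) g 0 t = ∑ n ∈ Finset.range M, ∫ u in (0 : ℝ)..t,
      blockStrategyDeriv x (G.point n) (G.ε n) (G.θ n) (G.N n) u * (g t - g u) := by
  obtain ⟨L, hL⟩ := exists_bound_sum (Finset.range M) fun n _ =>
    exists_bound_blockStrategyDeriv x (G.point n) (G.ε n) (G.θ n) (G.N n)
  have heq : ∀ u ≤ t, G.strategy x u = _ := fun u hu => G.strategy_eq_sum x (hu.trans hM)
  have hgc := continuous_of_holder (lt_trans (by linarith) hα) hg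
  have hc := fun n => continuous_blockStrategyDeriv x (G.point n) (G.ε n) (G.θ n) (G.N n)
  rw [glsIntegral_congr β (fun u hu => heq u hu.2) (fun _ _ => rfl) ht0,
    glsIntegral_eq_of_holder (G.hasDerivAt_partial x M) (by fun_prop) hL ?_ hg hβ hβ1 hα ht0]
  · simp_rw [Finset.sum_mul]
    refine intervalIntegral.integral_finsetSum fun n _ => Continuous.intervalIntegrable ?_ _ _
    exact (hc n).mul (continuous_const.sub hgc)
  · rw [← heq 0 ht0, strategy_zero]

/-- Between `u` and the grid point to its left the path moves by at most `C * mesh^α ≤ C 2^(-n) ε ≤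
ε`; passing to the grid thus costs half of the level `2ε`. -/
theorem exists_point_hit {g : ℝ → ℝ} {C : ℝ} (hα : 0 < α)
    (hg : ∀ x y, |g x - g y| ≤ C * |x - y| ^ α) {n : ℕ} (hn : C * (1 / 2) ^ n ≤ 1)
    (hu : ∃ u ∈ Set.Icc (G.τ n) (G.τ (n + 1)), 2 * G.ε n < |g u - g (G.τ n)|) :
    ∃ k ≤ G.N n, G.ε n ≤ |g (G.point n k) - g (G.τ n)| := by
  obtain ⟨u, hu, hgu⟩ := hu
  have hC := nonneg_of_holder hg
  have hm := G.mesh_pos n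
  have hnn : 0 ≤ (u - G.τ n) / G.mesh n := div_nonneg (by linarith [hu.1]) hm.le
  refine ⟨⌊(u - G.τ n) / G.mesh n⌋₊, ?_, ?_⟩
  · refine Nat.floor_le_of_le ?_
    rw [div_le_iff₀ hm]
    have := G.point_N n
    rw [point] at this
    linarith [hu.2]
  · have h1 := Nat.floor_le hnn
    have h2 := Nat.lt_floor_add_one ((u - G.τ n) / G.mesh n)
    rw [le_div_iff₀ hm] at h1
    rw [div_lt_iff₀ hm] at h2
    set k := ⌊(u - G.τ n) / G.mesh n⌋₊
    have h3 : |u - G.point n k| ≤ G.mesh n := by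
      rw [point, abs_le]; constructor <;> linarith
    have h4 : |g u - g (G.point n k)| ≤ G.ε n := calc
      _ ≤ C * |u - G.point n k| ^ α := hg _ _
      _ ≤ C * G.mesh n ^ α := by gcongr
      _ ≤ C * ((1 / 2) ^ n * G.ε n) := mul_le_mul_of_nonneg_left (G.mesh_le n) hC
      _ = C * (1 / 2) ^ n * G.ε n := by ring
      _ ≤ 1 * G.ε n := mul_le_mul_of_nonneg_right hn (G.ε_pos n).le
      _ = G.ε n := one_mul _
    have h5 := abs_sub_le (g u) (g (G.point n k)) (g (G.τ n))
    linarith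

/-- At every time, each block contributes at least `-κ 2^(-n)`; a block from `n₀` on that is over by
time `t` contributes at least `1 - κ 2^(-n)`. -/
theorem tendsto_glsIntegral_strategy {g : ℝ → ℝ} {C β : ℝ}
    (hg : ∀ x y, |g x - g y| ≤ C * |x - y| ^ α) (hβ : 0 < β) (hβ1 : β < 1) (hα : 1 - β < α)
    (hhit : ∀ᶠ n in atTop, ∃ u ∈ Set.Icc (G.τ n) (G.τ (n + 1)),
      2 * G.ε n < |g u - g (G.τ n)|) :
    Tendsto (fun t => glsIntegral β (G.strategy g) g 0 t) (𝓝[<] 1) atTop := by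
  have hα0 : 0 < α := lt_trans (by linarith) hα
  have hC := nonneg_of_holder hg
  have hsmall : ∀ᶠ n : ℕ in atTop, C * (1 / 2 : ℝ) ^ n ≤ 1 := by
    have h := (tendsto_pow_atTop_nhds_zero_of_lt_one (r := (1 / 2 : ℝ)) (by norm_num)
      (by norm_num)).const_mul C
    rw [mul_zero] at h
    exact h.eventually_le_const one_pos
  obtain ⟨n₀, hn₀⟩ := eventually_atTop.1 (hhit.and hsmall)
  set κ := C ^ 2 + C with hκ
  have hκ0 : 0 ≤ κ := by positivity
  rw [tendsto_atTop]
  intro R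
  -- The total loss is at most `2κ`, so `j` completed successful blocks suffice to exceed `R`.
  obtain ⟨j, hj⟩ := exists_nat_ge (R + κ * 2)
  have hτ1 := G.τ_lt_one (n₀ + j)
  filter_upwards [Ico_mem_nhdsLT hτ1] with t ht
  have ht0 : 0 ≤ t := (G.τ_nonneg _).trans ht.1
  obtain ⟨M, hM⟩ := G.exists_lt_τ ht.2
  have hMj : n₀ + j < M := G.strictMono_τ.lt_iff_lt.1 (ht.1.trans_lt hM)
  rw [G.glsIntegral_strategy hg hβ hβ1 hα ht0 hM.le]
  set I : ℕ → ℝ := fun n => ∫ u in (0 : ℝ)..t,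
    blockStrategyDeriv g (G.point n) (G.ε n) (G.θ n) (G.N n) u * (g t - g u) with hI
  have hlow : ∀ n, (if ∀ k ≤ G.N n, |g (min (G.point n k) t) - g (min (G.point n 0) t)| < G.ε n
      then (0 : ℝ) else 1) ≤ I n + κ * (1 / 2) ^ n := fun n => by
    have h := integral_blockStrategyDeriv_ge (N := G.N n) hα0 hg (G.mesh_pos n).le (G.point_succ n)
      (by rw [point_zero]; exact G.τ_nonneg n) (G.ε_pos n) (G.θ_pos n) ht0
    have h1 := mul_le_mul_of_nonneg_left (G.sq_le n) (sq_nonneg C)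
    have h2 := mul_le_mul_of_nonneg_left (G.switch_le n) hC
    rw [← mesh] at h1
    have e : κ * (1 / 2 : ℝ) ^ n = C ^ 2 * (1 / 2) ^ n + C * (1 / 2) ^ n := by rw [hκ]; ring
    rw [e]
    linarith
  have hnn : ∀ n, 0 ≤ I n + κ * (1 / 2) ^ n := fun n =>
    le_trans (by split_ifs <;> norm_num) (hlow n)
  have hone : ∀ n ∈ Finset.Ico n₀ (n₀ + j), 1 ≤ I n + κ * (1 / 2) ^ n := fun n hn => by
    rw [Finset.mem_Ico] at hn
    obtain ⟨k, hk, hgk⟩ := G.exists_point_hit hα0 hg (hn₀ n hn.1).2 (hn₀ n hn.1).1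
    refine le_trans (le_of_eq ?_) (hlow n)
    rw [if_neg]
    intro hall
    have hle : ∀ i ≤ G.N n, G.point n i ≤ t := fun i hi => by
      refine (G.monotone_point n hi).trans ?_
      rw [point_N]
      exact (G.strictMono_τ.monotone (by omega)).trans ht.1
    have := hall k hk
    rw [min_eq_left (hle k hk), min_eq_left (hle 0 (Nat.zero_le _)), point_zero] at this
    linarith
  have hsum : (j : ℝ) ≤ ∑ n ∈ Finset.range M, (I n + κ * (1 / 2) ^ n) := calc
    (j : ℝ) = ∑ n ∈ Finset.Ico n₀ (n₀ + j), (1 : ℝ) := by simp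
    _ ≤ ∑ n ∈ Finset.Ico n₀ (n₀ + j), (I n + κ * (1 / 2) ^ n) := Finset.sum_le_sum hone
    _ ≤ _ := Finset.sum_le_sum_of_subset_of_nonneg (fun n hn => by
      rw [Finset.mem_Ico] at hn
      rw [Finset.mem_range]
      omega) fun n _ _ => hnn n
  rw [Finset.sum_add_distrib, ← Finset.mul_sum] at hsum
  have := mul_le_mul_of_nonneg_left (sum_geometric_two_le M) hκ0
  linarith

end GridSequence


/-! ### Choice of the grids -/

/-- The quadratic variation term is of order `N^(1 - 2α)`; here `α > 1/2` is essential. -/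
theorem exists_mesh {α Δ ε η : ℝ} (hα : 1 / 2 < α) (hΔ : 0 < Δ) (hε : 0 < ε) (hη : 0 < η) :
    ∃ N : ℕ, 0 < N ∧ (Δ / N) ^ α ≤ η * ε ∧ N * ((Δ / N) ^ α) ^ 2 / ε ^ 2 ≤ η := by
  have h1 : Tendsto (fun N : ℕ => (Δ / N) ^ α) atTop (𝓝 0) := by
    have := (tendsto_const_div_atTop_nhds_zero_nat Δ).rpow_const (p := α) (Or.inr (by linarith))
    rwa [Real.zero_rpow (by linarith)] at this
  have h2 : Tendsto (fun N : ℕ => N * ((Δ / N) ^ α) ^ 2 / ε ^ 2) atTop (𝓝 0) := by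
    have h := ((tendsto_rpow_neg_atTop (y := 2 * α - 1) (by linarith)).comp
      (tendsto_natCast_atTop_atTop (R := ℝ))).const_mul (Δ ^ (2 * α) / ε ^ 2)
    rw [mul_zero] at h
    refine h.congr' ?_
    filter_upwards [eventually_gt_atTop 0] with N hN
    have hN' : (0 : ℝ) < N := Nat.cast_pos.2 hN
    have e1 : ((Δ / N) ^ α) ^ 2 = Δ ^ (2 * α) / (N : ℝ) ^ (2 * α) := by
      rw [← Real.rpow_natCast, ← Real.rpow_mul (by positivity), Real.div_rpow hΔ.le hN'.le]
      norm_num [mul_comm]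
    have e2 : (N : ℝ) ^ (-(2 * α - 1)) = N / (N : ℝ) ^ (2 * α) := by
      rw [neg_sub, Real.rpow_sub hN', Real.rpow_one]
    simp only [Function.comp_apply]
    rw [e1, e2]
    ring
  obtain ⟨N, hN, h3, h4⟩ := ((eventually_gt_atTop 0).and
    ((h1.eventually_le_const (mul_pos hη hε)).and (h2.eventually_le_const hη))).exists
  exact ⟨N, hN, h3, h4⟩

theorem exists_switch {α K η : ℝ} (hα : 0 < α) (hη : 0 < η) : ∃ θ : ℝ, 0 < θ ∧ K * θ ^ α ≤ η := by
  have h : Tendsto (fun θ : ℝ => K * θ ^ α) (𝓝[>] 0) (𝓝 0) := by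
    have hc : Continuous fun θ : ℝ => K * θ ^ α :=
      continuous_const.mul (continuous_id.rpow_const fun _ => Or.inr hα.le)
    have := hc.tendsto 0
    rw [Real.zero_rpow hα.ne', mul_zero] at this
    exact this.mono_left nhdsWithin_le_nhds
  obtain ⟨θ, h1, h2⟩ := ((h.eventually_le_const hη).and self_mem_nhdsWithin).exists
  exact ⟨θ, h2, h1⟩

theorem exists_gridSequence {α : ℝ} (hα : 1 / 2 < α) {τ ε : ℕ → ℝ} (h0 : ∀ n, 0 ≤ τ n)
    (hτ : ∀ n, τ n < τ (n + 1)) (h1 : ∀ n, τ n < 1) (hlim : Tendsto τ atTop (𝓝 1))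
    (hε : ∀ n, 0 < ε n) : ∃ G : GridSequence α, G.τ = τ ∧ G.ε = ε := by
  have hη : ∀ n : ℕ, (0 : ℝ) < (1 / 2) ^ n := fun n => by positivity
  choose N hN hmesh hsq using fun n => exists_mesh hα (sub_pos.2 (hτ n)) (hε n) (hη n)
  choose θ hθ hsw using fun n =>
    exists_switch (α := α) (K := N n * (8 / ε n)) (by linarith) (hη n)
  exact ⟨⟨τ, N, ε, θ, h0, hτ, h1, hlim, hN, hε, hθ, hmesh, hsq, hsw⟩, rfl, rfl⟩

/-! ### Adaptedness -/

theorem measurable_stoppedPosition {Ω : Type*} [MeasurableSpace Ω] {x : ℕ → Ω → ℝ} {k : ℕ} (ε : ℝ)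
    (hx : ∀ j ≤ k, Measurable (x j)) : Measurable fun ω => stoppedPosition (fun j => x j ω) ε k := by
  have h0 := hx 0 (Nat.zero_le k)
  refine Measurable.ite ?_ (((hx k le_rfl).sub h0).const_mul _) measurable_const
  have e : {ω | ∀ j ≤ k, |x j ω - x 0 ω| < ε} =
      ⋂ j ∈ Finset.range (k + 1), {ω | |x j ω - x 0 ω| < ε} := by
    ext ω
    simp
  rw [e]
  refine Finset.measurableSet_biInter _ fun j hj => ?_
  have hj' := hx j (Nat.lt_succ_iff.1 (Finset.mem_range.1 hj))
  exact measurableSet_lt (hj'.sub h0).abs measurable_const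

/-- Terms whose grid point lies after `t` vanish at `t`; the others depend only on values of the
path up to `t`. -/
theorem GridSequence.measurable_strategy {Ω : Type*} [MeasurableSpace Ω] {α : ℝ}
    (G : GridSequence α) {x : ℝ → Ω → ℝ} {t : ℝ} (ht : t < 1)
    (hx : ∀ s ≤ t, Measurable (x s)) : Measurable fun ω => G.strategy (fun s => x s ω) t := by
  obtain ⟨M, hM⟩ := G.exists_lt_τ ht
  simp_rw [G.strategy_eq_sum _ hM.le]
  refine Finset.measurable_fun_sum _ fun n _ => Finset.measurable_fun_sum _ fun k _ => ?_
  rcases le_total (G.point n k) t with h | h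
  · exact (measurable_stoppedPosition _ fun j hj =>
      hx _ ((G.monotone_point n hj).trans h)).mul_const _
  · rw [smoothStep_of_le (G.θ_pos n) h,
      smoothStep_of_le (G.θ_pos n) (h.trans (G.monotone_point n k.le_succ))]
    simp

/-! ### Borel–Cantelli and the conclusion -/

/-- The process `X` on `[0, 1]`, kept constant before time `0` and after time `1`. -/
noncomputable def clampedPath {Ω : Type*} (X : ℝ → Ω → ℝ) (t : ℝ) (ω : Ω) : ℝ :=
  X (Set.projIcc (0 : ℝ) 1 zero_le_one t) ω

theorem clampedPath_of_mem {Ω : Type*} (X : ℝ → Ω → ℝ) {t : ℝ} (ht : t ∈ Set.Icc (0 : ℝ) 1)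
    (ω : Ω) : clampedPath X t ω = X t ω := by
  rw [clampedPath, Set.projIcc_of_mem _ ht]

theorem clampedPath_holder {Ω : Type*} {X : ℝ → Ω → ℝ} {ω : Ω} {C α : ℝ} (hα : 0 < α)
    (h : ∀ s ∈ Set.Icc (0 : ℝ) 1, ∀ t ∈ Set.Icc (0 : ℝ) 1, |X t ω - X s ω| ≤ C * |t - s| ^ α)
    (x y : ℝ) : |clampedPath X x ω - clampedPath X y ω| ≤ C * |x - y| ^ α := by
  have hC : 0 ≤ C := by
    have := (abs_nonneg _).trans (h 0 (by simp) 1 (by simp))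
    simpa using this
  refine (h _ (Subtype.prop _) _ (Subtype.prop _)).trans (mul_le_mul_of_nonneg_left
    (Real.rpow_le_rpow (abs_nonneg _) (Set.abs_projIcc_sub_projIcc _) hα.le) hC)

/-- Borel–Cantelli for the small ball estimate on the intervals
`[1 - δ / 2 ^ n, 1 - δ / 2 ^ (n + 1)]`. -/
theorem ae_eventually_exists_large_increment {Ω : Type*} [MeasurableSpace Ω] {P : Measure Ω}
    {X : ℝ → Ω → ℝ} {α C δ : ℝ} (hα : 0 < α) (hC : 0 < C) (hδ : 0 < δ) (hδ1 : δ ≤ 1)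
    (h : ∀ s ∈ Set.Icc (1 - δ) 1, ∀ t ∈ Set.Icc (1 - δ) 1, s < t →
      ∀ ε : ℝ, 0 < ε → ε ≤ (t - s) ^ α →
        P {ω | ∀ u ∈ Set.Icc s t, |X u ω - X s ω| ≤ ε} ≤
          ENNReal.ofReal (Real.exp (-(C * (t - s) * ε ^ (-(1 / α)))))) :
    ∀ᵐ ω ∂P, ∀ᶠ n : ℕ in atTop, ∃ u ∈ Set.Icc (1 - δ / 2 ^ n) (1 - δ / 2 ^ (n + 1)),
      (δ / 2 ^ (n + 1)) ^ (2 * α) < |X u ω - X (1 - δ / 2 ^ n) ω| := by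
  have hmem : ∀ n : ℕ, 1 - δ / 2 ^ n ∈ Set.Icc (1 - δ) 1 := fun n => by
    have h1 : δ / 2 ^ n ≤ δ := div_le_self hδ.le (one_le_pow₀ one_le_two)
    have h2 : 0 < δ / 2 ^ n := by positivity
    constructor <;> linarith
  have hdiff : ∀ n : ℕ, (1 - δ / 2 ^ (n + 1)) - (1 - δ / 2 ^ n) = δ / 2 ^ (n + 1) := fun n => by
    field_simp
    ring
  have hbound : ∀ n : ℕ, P {ω | ∀ u ∈ Set.Icc (1 - δ / 2 ^ n) (1 - δ / 2 ^ (n + 1)),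
      |X u ω - X (1 - δ / 2 ^ n) ω| ≤ (δ / 2 ^ (n + 1)) ^ (2 * α)} ≤
      ENNReal.ofReal (δ / (2 * C) * (1 / 2) ^ n) := fun n => by
    set Δ := δ / 2 ^ (n + 1) with hΔ
    have hΔ0 : 0 < Δ := by positivity
    have hΔ1 : Δ ≤ 1 := (div_le_self hδ.le (one_le_pow₀ one_le_two)).trans hδ1
    have h1 := h _ (hmem n) _ (hmem (n + 1)) (by linarith [hdiff n]) (Δ ^ (2 * α))
      (by positivity) (by
        rw [hdiff]
        exact Real.rpow_le_rpow_of_exponent_ge hΔ0 hΔ1 (by linarith))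
    refine h1.trans (ENNReal.ofReal_le_ofReal ?_)
    -- With the level `Δ^(2α)` the exponent is `C Δ Δ^(-2) = C/Δ`, and `exp(-C/Δ) ≤ Δ/C` is a
    -- geometric sequence in `n`.
    rw [hdiff n, ← hΔ, ← Real.rpow_mul hΔ0.le,
      show 2 * α * -(1 / α) = -(2 : ℕ) by field_simp; norm_num, Real.rpow_neg hΔ0.le,
      Real.rpow_natCast]
    have e1 : C * Δ * (Δ ^ 2)⁻¹ = C / Δ := by field_simp
    have e2 : δ / (2 * C) * (1 / 2) ^ n = (C / Δ)⁻¹ := by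
      rw [hΔ, one_div, inv_pow]
      field_simp
      ring
    rw [e1, e2, Real.exp_neg]
    gcongr
    linarith [Real.add_one_le_exp (C / Δ)]
  have hsum : Summable fun n : ℕ => δ / (2 * C) * (1 / 2 : ℝ) ^ n := summable_geometric_two.mul_left _
  have hfin := ne_top_of_le_ne_top hsum.tsum_ofReal_ne_top (ENNReal.tsum_le_tsum hbound)
  filter_upwards [ae_eventually_notMem hfin] with ω hω
  filter_upwards [hω] with n hn
  simpa [and_assoc] using hn

theorem mainTheorem5 {Ω : Type*} [mΩ : MeasurableSpace Ω] (P : Measure Ω) [IsProbabilityMeasure P]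
    (𝓕 : Filtration (Set.Icc (0 : ℝ) 1) mΩ)
    (X : ℝ → Ω → ℝ) (hX : ∀ t : Set.Icc (0 : ℝ) 1, Measurable[𝓕 t] (X t))
    (α : ℝ) (hα : 1 / 2 < α)
    (hHolder : HasHolderPaths P X α) (hSmall : HasSmallBallEstimate P X α) :
    ∃ φ : ℝ → Ω → ℝ,
      (∀ t : Set.Icc (0 : ℝ) 1, (t : ℝ) < 1 → Measurable[𝓕 t] (φ t)) ∧
      (∀ ω, ContinuousOn (fun t => φ t ω) (Set.Ico 0 1)) ∧
      (∀ ω, φ 0 ω = 0) ∧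
      ∀ᵐ ω ∂P, ∀ β : ℝ, 0 < β → 1 - α < β → β < 1 →
        (∀ t ∈ Set.Ico (0 : ℝ) 1,
          GLSIntegrable β (fun s => φ s ω) (fun s => X s ω) 0 t) ∧
        Tendsto (fun t => glsIntegral β (fun s => φ s ω) (fun s => X s ω) 0 t)
          (𝓝[<] 1) atTop := by
  obtain ⟨C₀, hC₀, δ, hδ, hδ1, hball⟩ := hSmall
  have hα0 : 0 < α := by linarith
  have hlim : Tendsto (fun n : ℕ => 1 - δ / 2 ^ n) atTop (𝓝 1) := by
    have h := (tendsto_pow_atTop_nhds_zero_of_lt_one (r := (1 / 2 : ℝ)) (by norm_num)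
      (by norm_num)).const_mul δ
    have h2 := h.const_sub 1
    simpa [div_eq_mul_inv] using h2
  have h2n : ∀ n : ℕ, 0 < δ / 2 ^ n := fun n => by positivity
  -- The level is half the one from Borel–Cantelli, to leave room for passing to grid points.
  obtain ⟨G, hτ, hε⟩ := exists_gridSequence hα (τ := fun n : ℕ => 1 - δ / 2 ^ n)
    (ε := fun n : ℕ => (δ / 2 ^ (n + 1)) ^ (2 * α) / 2)
    (fun n => by linarith [div_le_self hδ.le (one_le_pow₀ (n := n) one_le_two)])
    (fun n => by
      have := h2n n
      have e : δ / 2 ^ (n + 1) = δ / 2 ^ n / 2 := by rw [pow_succ, div_div]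
      rw [e]
      linarith) (fun n => by linarith [h2n n]) hlim
    (fun n => half_pos (Real.rpow_pos_of_pos (h2n _) _))
  refine ⟨fun t ω => G.strategy (fun s => clampedPath X s ω) t, fun t ht => ?_, fun ω =>
    (G.continuousOn_strategy _).mono fun t ht => ht.2, fun ω => G.strategy_zero _, ?_⟩
  · refine @GridSequence.measurable_strategy Ω (𝓕 t) α G (clampedPath X) t ht fun s hs => ?_
    -- Clamping is monotone and fixes `t`, so a clamped time `s ≤ t` still lies in the past of `t`.
    refine (hX _).mono (𝓕.mono ?_) le_rfl
    rw [← Set.projIcc_val zero_le_one t]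
    exact Set.monotone_projIcc _ hs
  -- Neither almost sure event involves `β`, so one null set serves all `β`.
  · filter_upwards [hHolder, ae_eventually_exists_large_increment hα0 hC₀ hδ hδ1 hball]
      with ω ⟨C, hω⟩ hinc β hβ hβα hβ1
    have hg := clampedPath_holder hα0 hω
    have heq : ∀ t ≤ 1, Set.EqOn (fun s => X s ω) (fun s => clampedPath X s ω) (Set.Icc 0 t) :=
      fun t ht s hs => (clampedPath_of_mem X ⟨hs.1, hs.2.trans ht⟩ ω).symm
    have hαβ : 1 - β < α := by linarith
    refine ⟨fun t ht => (G.glsIntegrable_strategy hg hβ hβ1 hαβ ht.1 ht.2).congr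
      (fun _ _ => rfl) (heq t ht.2.le) ht.1, ?_⟩
    refine (G.tendsto_glsIntegral_strategy hg hβ hβ1 hαβ ?_).congr' ?_
    · filter_upwards [hinc] with n ⟨u, hu, hlt⟩
      have hτn := fun n => congrFun hτ n
      have hεn := congrFun hε n
      have hmem := fun n => (⟨G.τ_nonneg n, (G.τ_lt_one n).le⟩ : G.τ n ∈ Set.Icc (0 : ℝ) 1)
      refine ⟨u, by rwa [hτn, hτn], ?_⟩
      rw [← hτn, ← hτn] at hu
      rw [clampedPath_of_mem X ⟨(G.τ_nonneg n).trans hu.1, hu.2.trans (hmem (n + 1)).2⟩,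
        clampedPath_of_mem X (hmem n), hτn, hεn, mul_div_cancel₀ _ two_ne_zero]
      exact hlt
    · filter_upwards [Ico_mem_nhdsLT (zero_lt_one' ℝ)] with t ht
      exact (glsIntegral_congr β (fun _ _ => rfl) (heq t ht.2.le) ht.1).symm
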